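/- Let $\mathbb{T}=\mathbb{R}/2\pi\mathbb{Z}$ and let $\mathcal{M}(\mathbb{T})$ be the space of real Radon measures (finite signed Borel measures) on $\mathbb{T}$, with total-variation norm $\|w\|_{\mathcal{M}}=|w|(\mathbb{T})$ and Fourier coefficients $\widehat{w}[k]=\int_{\mathbb{T}}e^{-ikt}\,\mathrm{d}w(t)$, $k\in\mathbb{Z}$. Let $K_c\ge 0$ be an integer and let $(y_k)_{|k|\le K_c}$ be complex numbers with $y_{-k}=\overline{y_k}$ for all $|k|\le K_c$ (in particular $y_0\in\mathbb{R}$). Consider the problem $$\text{(BPC)}\qquad \min_{w\in\mathcal{M}(\mathbb{T})}\ \|w\|_{\mathcal{M}}\quad\text{subject to}\quad \widehat{w}[k]=y_k\ \text{ for all } |k|\le K_c,$$ and the Hermitian Toeplitz matrix $T_y=(y_{j-i})_{0\le i,j\le K_c}\in\mathbb{C}^{(K_c+1)\times(K_c+1)}$. A measure is said to be composed of $n$ Dirac masses if it equals $\sum_{i=1}^n a_i\delta_{x_i}$ with pairwise distinct $x_i\in\mathbb{T}$ and nonzero real weights $a_i$ (it is the zero measure if $n=0$). Theorem. (a) If $T_y$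 has at least one negative and at least one positive eigenvalue, then (BPC) has a unique solution; it is composed of at most $2K_c$ Dirac masses, with at least one positive and at least one negative weight. (b) If $T_y$ is positive (respectively negative) semidefinite and $\operatorname{rank}(T_y)<K_c+1$, then (BPC) has a unique solution; it is composed of exactly $\operatorname{rank}(T_y)$ Dirac masses, all with positive (respectively negative) weights. (c) If $T_y$ is positive (respectively negative) definite, then $\operatorname{rank}(T_y)=K_c+1$ and (BPC) has infinitely many solutions; none of them is a sum of fewer than $K_c+1$ weighted Dirac masses, and uncountably many of them are composed of exactly $K_c+1$ Dirac masses with positive (respectively negative) weights. -/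

import Mathlib

open MeasureTheory ComplexConjugate
open scoped ComplexOrder

noncomputable section

namespace BPC

/-- The torus `𝕋 = ℝ / 2πℤ`, with its Borel σ-algebra. -/
abbrev Torus : Type := AddCircle (2 * Real.pi)

/-- Real Radon measures on the compact metric space `𝕋` are the finite signed Borel measures. -/
abbrev RadonMeasure : Type := SignedMeasure Torus

/-- The total-variation norm `‖w‖ = |w|(𝕋)`. -/
def tvNorm (w : RadonMeasure) : ℝ := w.totalVariation.real Set.univ

/-- The Fourier coefficient `ŵ[k] = ∫ e^{-ikt} dw(t)`
(`fourier (-k)` is the character `t ↦ e^{-ikt}` of `𝕋`). -/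
def fourierCoefficient (w : RadonMeasure) (k : ℤ) : ℂ :=
  VectorMeasure.integral w (fun t => fourier (-k) t) (ContinuousLinearMap.lsmul ℝ ℝ).flip

/-- The measures `w` satisfying the constraints `ŵ[k] = y_k`, `|k| ≤ K`. -/
def feasibleSet (K : ℕ) (y : ℤ → ℂ) : Set RadonMeasure :=
  {w | ∀ k : ℤ, |k| ≤ (K : ℤ) → fourierCoefficient w k = y k}

/-- The solution set of the minimisation of the total-variation norm under the constraints
`ŵ[k] = y_k`, `|k| ≤ K`. -/
def solutionSet (K : ℕ) (y : ℤ → ℂ) : Set RadonMeasure :=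
  {w | w ∈ feasibleSet K y ∧ ∀ v ∈ feasibleSet K y, tvNorm w ≤ tvNorm v}

/-- The `(K+1) × (K+1)` Toeplitz matrix with `(i, j)` entry `y_{j-i}`. -/
def toeplitz (K : ℕ) (y : ℤ → ℂ) : Matrix (Fin (K + 1)) (Fin (K + 1)) ℂ :=
  Matrix.of fun i j => y ((j : ℤ) - (i : ℤ))

/-- The measure `∑ i, a i • δ_{x i}`. -/
def diracSum {n : ℕ} (a : Fin n → ℝ) (x : Fin n → Torus) : RadonMeasure :=
  ∑ i, VectorMeasure.dirac (x i) (a i)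

/-- `w` is composed of exactly `n` Dirac masses, with nonzero weights `a` at the pairwise distinct
positions `x`. -/
structure IsComposedOf {n : ℕ} (w : RadonMeasure) (a : Fin n → ℝ) (x : Fin n → Torus) : Prop where
  injective : Function.Injective x
  ne_zero : ∀ i, a i ≠ 0
  eq_diracSum : w = diracSum a x

end BPC

end

/-! Duality reduces everything to a real trigonometric polynomial `η` of degree at most `K` with
`|η| ≤ 1`. The moment vectors of points form a compact family spanning the conjugate-symmetric
vectors, so the hull of this family and its opposite is the unit ball of an atomic norm. Hahn–Banach
at `y` gives `η` together with a discrete feasible measure whose norm `η` certifies. By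
complementary slackness, every solution has its positive part on `{η = 1}` and its negative part on
`{η = -1}` (`exists_certificate`).

Unless `η` is identically `1`, the nonnegative polynomial `1 - η` has only double zeros, hence at
most `K` of them; likewise for `1 + η`. The Vandermonde determinant makes measures on a common set
of `2K + 1` points unique given their moments (`eq_of_mem_feasibleSet`).

The matrix enters through `u* T u = ∫ |p_u|² dw`, where `p_u` is the polynomial with coefficients
`u`. An indefinite `T` excludes constant `η = ±1` and forces both signs. If `T ≥ 0`, testing with
the polynomial vanishing on `{η = 1}` kills the negative part; a kernel vector then confines the
solutions to at most `K` points, and the rank counts the atoms. If `T > 0`, a suitable multiple of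
`δ_s` can be subtracted for any `s` to reach the singular case. Adding it back gives a solution with
`K + 1` atoms, one of them at `s`; as `s` is arbitrary, there are uncountably many. Negative cases
follow by `w ↦ -w`. -/

/-! ### Convex duality in finite dimension. -/

open Topology in
/-- In finite dimension the convex hull of a compact set is compact. -/
theorem isCompact_convexHull_of_finiteDimensional {F : Type*} [NormedAddCommGroup F]
    [NormedSpace ℝ F] [FiniteDimensional ℝ F] {s : Set F} (hs : IsCompact s) :
    IsCompact (convexHull ℝ s) := by
  -- By Carathéodory, `d` points suffice, so the hull is the continuous image of a simplex times `s
  -- ^ d`.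
  set d := Module.finrank ℝ F + 1
  let Φ : (Fin d → ℝ) × (Fin d → F) → F := fun p => ∑ i, p.1 i • p.2 i
  have hΦ : Continuous Φ := by fun_prop
  have hc : IsCompact (stdSimplex ℝ (Fin d) ×ˢ Set.pi Set.univ fun _ : Fin d => s) :=
    (isCompact_stdSimplex ℝ (Fin d)).prod (isCompact_univ_pi fun _ => hs)
  convert hc.image hΦ using 1
  ext v
  constructor
  · intro hv
    obtain ⟨ι, _, z, w, hz, hind, hw, hw1, hv⟩ := eq_pos_convex_span_of_mem_convexHull hv
    have hcard : Fintype.card ι ≤ Fintype.card (Fin d) := by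
      rw [Fintype.card_fin]
      exact hind.card_le_finrank_succ.trans
        (Nat.succ_le_succ (Submodule.finrank_le _))
    obtain ⟨e⟩ := Function.Embedding.nonempty_of_card_le hcard
    have hne : Nonempty ι := by
      by_contra h
      rw [not_nonempty_iff] at h
      simp at hw1
    obtain ⟨i₀⟩ := hne
    -- Unused slots get weight zero and an arbitrary point of `s`.
    refine ⟨(Function.extend e w 0, Function.extend e z fun _ => z i₀), ⟨⟨?_, ?_⟩, ?_⟩, ?_⟩
    · intro j
      by_cases hj : ∃ i, e i = j
      · obtain ⟨i, rfl⟩ := hj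
        simpa [e.injective.extend_apply] using (hw i).le
      · simp [Function.extend_apply' _ _ _ hj]
    · rw [← hw1]
      symm
      apply Finset.sum_of_injOn e (e.injective.injOn) (by simp)
      · intro j _ hj
        exact Function.extend_apply' _ _ _ (by simpa using hj)
      · intro i _
        simp [e.injective.extend_apply]
    · intro j _
      by_cases hj : ∃ i, e i = j
      · obtain ⟨i, rfl⟩ := hj
        simpa [e.injective.extend_apply] using hz ⟨i, rfl⟩
      · simpa [Function.extend_apply' _ _ _ hj] using hz ⟨i₀, rfl⟩
    · rw [← hv]
      symm
      apply Finset.sum_of_injOn e (e.injective.injOn) (by simp)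
      · intro j _ hj
        simp [Function.extend_apply' w _ _ (show ¬ ∃ i, e i = j by simpa using hj)]
      · intro i _
        simp [e.injective.extend_apply]
  · rintro ⟨⟨w, z⟩, ⟨⟨h0, h1⟩, hz⟩, rfl⟩
    exact (convex_convexHull ℝ s).sum_mem (fun i _ => h0 i) h1
      fun i _ => subset_convexHull ℝ s (hz i trivial)

open Topology in
/-- Attainment and duality for the atomic norm generated by a compact family `φ` of vectors
spanning a finite-dimensional space. -/
theorem exists_dual_certificate_of_span_eq_top {F X : Type*} [NormedAddCommGroup F]
    [NormedSpace ℝ F] [FiniteDimensional ℝ F] [TopologicalSpace X] [CompactSpace X] {φ : X → F}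
    (hφ : Continuous φ) (hspan : Submodule.span ℝ (Set.range φ) = ⊤) (y : F) :
    ∃ (g : F →ₗ[ℝ] ℝ) (n : ℕ) (a : Fin n → ℝ) (x : Fin n → X),
      (∀ x, |g (φ x)| ≤ 1) ∧ ∑ i, a i • φ (x i) = y ∧ g y = ∑ i, |a i| := by
  rcases eq_or_ne y 0 with rfl | hy
  · exact ⟨0, 0, 0, Fin.elim0, by simp, by simp, by simp⟩
  have hX : Nonempty X := by
    by_contra h
    rw [not_nonempty_iff] at h
    rw [Set.range_eq_empty, Submodule.span_empty] at hspan
    exact hy ((Submodule.mem_bot ℝ).1 (hspan ▸ Submodule.mem_top))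
  set S : Set F := Set.range φ ∪ -Set.range φ
  set C := convexHull ℝ S
  have hSn : ∀ v ∈ S, -v ∈ S := by
    rintro v (h | h)
    · right; simpa using h
    · left; simpa using h
  have hCn : ∀ v ∈ C, -v ∈ C := by
    intro v hv
    have : -C = C := by
      rw [← convexHull_neg]
      congr 1
      ext v; exact ⟨fun h => by simpa using hSn _ h, fun h => hSn _ h⟩
    rw [← this]; simpa using hv
  have hconv : Convex ℝ C := convex_convexHull ℝ S
  have hSc : IsCompact S := by
    have h := isCompact_range hφ
    exact h.union h.neg
  have hC : IsCompact C := isCompact_convexHull_of_finiteDimensional hSc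
  have hint : (interior C).Nonempty := by
    rw [interior_convexHull_nonempty_iff_affineSpan_eq_top,
      AffineSubspace.affineSpan_eq_top_iff_vectorSpan_eq_top_of_nonempty]
    · rw [eq_top_iff, ← hspan, Submodule.span_le]
      rintro _ ⟨x, rfl⟩
      have h1 : φ x ∈ S := Or.inl ⟨x, rfl⟩
      have h2 := (vectorSpan ℝ S).smul_mem (1 / 2 : ℝ) (vsub_mem_vectorSpan ℝ h1 (hSn _ h1))
      have h3 : (1 / 2 : ℝ) • (φ x -ᵥ -φ x) = φ x := by
        rw [vsub_eq_sub, sub_neg_eq_add, ← two_smul ℝ, smul_smul]; norm_num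
      rwa [h3] at h2
    · exact ⟨φ hX.some, Or.inl ⟨_, rfl⟩⟩
  -- By symmetry, `0` is the midpoint of an interior point `v` and of `-v`.
  have h0 : C ∈ 𝓝 (0 : F) := by
    obtain ⟨v, hv⟩ := hint
    have := hconv.combo_interior_self_mem_interior hv (hCn v (interior_subset hv))
      (show (0 : ℝ) < 1 / 2 by norm_num) (show (0 : ℝ) ≤ 1 / 2 by norm_num) (by norm_num)
    rw [smul_neg, add_neg_cancel] at this
    exact mem_interior_iff_mem_nhds.1 this
  have habs : Absorbent ℝ C := absorbent_nhds_zero h0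
  set m := gauge C y
  have hm : 0 < m := (gauge_pos habs
    (NormedSpace.isVonNBounded_iff ℝ |>.2 hC.isBounded)).2 hy
  -- Hahn–Banach: the functional `c • y ↦ c * m` on the line of `y` is dominated by the gauge of
  -- `C`.
  obtain ⟨g, hg, hgC⟩ := exists_extension_of_le_sublinear
    (LinearPMap.mkSpanSingleton y m hy) (gauge C)
    (fun c hc x => gauge_smul_of_nonneg hc.le x) (gauge_add_le hconv habs) (by
      rintro ⟨v, hv⟩
      obtain ⟨c, rfl⟩ := Submodule.mem_span_singleton.1 hv
      change LinearPMap.mkSpanSingleton' y m _ ⟨c • y, hv⟩ ≤ _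
      rw [LinearPMap.mkSpanSingleton'_apply]
      rcases le_total 0 c with hc | hc
      · rw [gauge_smul_of_nonneg hc]
        exact le_of_eq rfl
      · exact (mul_nonpos_of_nonpos_of_nonneg hc hm.le).trans (gauge_nonneg _))
  have hgy : g y = m := by
    have := hg ⟨y, Submodule.mem_span_singleton_self y⟩
    rw [this]
    exact LinearPMap.mkSpanSingleton_apply ℝ ℝ hy m
  have hz : m⁻¹ • y ∈ C := by
    rw [← hC.isClosed.closure_eq, ← gauge_le_one_iff_mem_closure hconv h0,
      gauge_smul_of_nonneg (inv_nonneg.2 hm.le)]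
    exact (inv_mul_cancel₀ hm.ne').le
  obtain ⟨ι, _, z, w, hzS, -, hw, hw1, hsum⟩ := eq_pos_convex_span_of_mem_convexHull hz
  have hsign : ∀ i, ∃ (ε : ℝ) (x : X), |ε| = 1 ∧ z i = ε • φ x := by
    intro i
    rcases hzS ⟨i, rfl⟩ with ⟨x, hx⟩ | ⟨x, hx⟩
    · exact ⟨1, x, by simp, by simp [hx]⟩
    · exact ⟨-1, x, by simp, by simp [hx]⟩
  choose ε x hε hzx using hsign
  let e := Fintype.equivFin ι
  refine ⟨g, Fintype.card ι, fun j => m * w (e.symm j) * ε (e.symm j), fun j => x (e.symm j),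
    ?_, ?_, ?_⟩
  · intro x
    have h1 : φ x ∈ S := Or.inl ⟨x, rfl⟩
    have h2 := (hgC _).trans (gauge_le_one_of_mem (subset_convexHull ℝ S h1))
    have h3 := (hgC _).trans (gauge_le_one_of_mem (subset_convexHull ℝ S (hSn _ h1)))
    rw [map_neg] at h3
    exact abs_le.2 ⟨by linarith, h2⟩
  · rw [Equiv.sum_comp e.symm fun i => (m * w i * ε i) • φ (x i)]
    calc ∑ i, (m * w i * ε i) • φ (x i) = m • ∑ i, w i • z i := by
          rw [Finset.smul_sum]
          exact Finset.sum_congr rfl fun i _ => by rw [hzx, smul_smul, smul_smul, mul_assoc]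
      _ = y := by rw [hsum, smul_smul, mul_inv_cancel₀ hm.ne', one_smul]
  · rw [Equiv.sum_comp e.symm fun i => |m * w i * ε i|, hgy]
    simp only [abs_mul, hε, abs_of_pos hm, abs_of_pos (hw _), mul_one]
    rw [← Finset.mul_sum, hw1, mul_one]

/-- Attainment and duality for the atomic norm generated by a compact family of vectors. -/
theorem exists_dual_certificate {E X : Type*} [NormedAddCommGroup E]
    [NormedSpace ℝ E] [FiniteDimensional ℝ E] [TopologicalSpace X] [CompactSpace X] {φ : X → E}
    (hφ : Continuous φ) {y : E} (hy : y ∈ Submodule.span ℝ (Set.range φ)) :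
    ∃ (g : E →ₗ[ℝ] ℝ) (n : ℕ) (a : Fin n → ℝ) (x : Fin n → X),
      (∀ x, |g (φ x)| ≤ 1) ∧ ∑ i, a i • φ (x i) = y ∧ g y = ∑ i, |a i| := by
  -- Inside its span, the family has a symmetric hull with nonempty interior; the functional found
  -- there is then extended.
  set V := Submodule.span ℝ (Set.range φ)
  let ψ : X → V := fun x => ⟨φ x, Submodule.subset_span ⟨x, rfl⟩⟩
  have hψ : Continuous ψ := hφ.subtype_mk _
  have hspan : Submodule.span ℝ (Set.range ψ) = ⊤ := by
    have : Set.range ψ = (Subtype.val : V → E) ⁻¹' Set.range φ := by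
      ext v; constructor
      · rintro ⟨x, rfl⟩; exact ⟨x, rfl⟩
      · rintro ⟨x, hx⟩; exact ⟨x, Subtype.ext hx⟩
    rw [this]
    exact Submodule.span_span_coe_preimage
  obtain ⟨g, n, a, x, h1, h2, h3⟩ := exists_dual_certificate_of_span_eq_top hψ hspan ⟨y, hy⟩
  obtain ⟨G, hG⟩ := g.exists_extend
  have hG' : ∀ v : V, G v = g v := fun v => LinearMap.congr_fun hG v
  refine ⟨G, n, a, x, fun x => ?_, ?_, ?_⟩
  · simpa only [← hG'] using h1 x
  · simpa [ψ] using congrArg Subtype.val h2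
  · rw [← h3, ← hG']

namespace BPC

/-! ### Trigonometric polynomials and their zeros. -/

instance : Fact (0 < 2 * Real.pi) := ⟨Real.two_pi_pos⟩

/-- The point `e^{-ix}` of the unit circle. -/
noncomputable def phase (x : Torus) : ℂ := fourier (-1) x

/-- The trigonometric sum `∑_{|k| ≤ K} d_k e^{-ikx}`. -/
noncomputable def trig (K : ℕ) (d : ℤ → ℂ) (x : Torus) : ℂ :=
  ∑ k ∈ Finset.Icc (-(K : ℤ)) K, d k * fourier (-k) x

/-- The polynomial `∑_{j ≤ 2K} d_{j-K} X^j`. -/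
noncomputable def trigPoly (K : ℕ) (d : ℤ → ℂ) : Polynomial ℂ :=
  ∑ j ∈ Finset.range (2 * K + 1), Polynomial.C (d ((j : ℤ) - K)) * Polynomial.X ^ j

lemma fourier_neg_natCast (j : ℕ) (x : Torus) : fourier (-(j : ℤ)) x = phase x ^ j := by
  induction j with
  | zero => simp
  | succ n ih =>
    rw [pow_succ, ← ih, phase, ← fourier_add]
    congr 2
    push_cast; ring

lemma fourier_neg_sub_natCast (i j : ℕ) (x : Torus) :
    (fourier (-((j : ℤ) - (i : ℤ))) x : ℂ) = conj (phase x ^ i) * phase x ^ j := by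
  rw [← fourier_neg_natCast, ← fourier_neg_natCast, ← fourier_neg, ← fourier_add]
  congr 2; ring

lemma fourier_ne_zero (k : ℤ) (x : Torus) : fourier k x ≠ 0 := by
  rw [fourier_apply]
  exact Circle.coe_ne_zero _

lemma phase_injective : Function.Injective phase := by
  intro x y h
  simp only [phase, fourier_apply, neg_smul, one_smul] at h
  exact neg_injective (AddCircle.injective_toCircle Real.two_pi_pos.ne' (Subtype.ext h))

lemma infinite_range_phase : (Set.range phase).Infinite := by
  have : Infinite Torus := by
    have : Infinite (Set.Ico (0 : ℝ) (0 + 2 * Real.pi)) :=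
      (Set.Ico_infinite (by simpa using Real.pi_pos)).to_subtype
    exact Infinite.of_injective _ (AddCircle.equivIco (2 * Real.pi) 0).symm.injective
  exact Set.infinite_range_of_injective phase_injective

lemma continuous_trig (K : ℕ) (d : ℤ → ℂ) : Continuous (trig K d) := by
  unfold trig
  fun_prop

lemma sum_Icc_eq_sum_range {M : Type*} [AddCommMonoid M] (K : ℕ) (f : ℤ → M) :
    ∑ k ∈ Finset.Icc (-(K : ℤ)) K, f k = ∑ j ∈ Finset.range (2 * K + 1), f ((j : ℤ) - K) := by
  symm
  apply Finset.sum_bij' (fun (j : ℕ) _ => (j : ℤ) - K) (fun k _ => (k + K).toNat)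
  all_goals
    intros
    simp only [Finset.mem_range, Finset.mem_Icc] at *
    first | omega | skip

/-- The factor `e^{-iKx}` shifts the frequencies `-K, …, K` to `0, …, 2K`. It never vanishes, so
zeros of `trig` become roots of an algebraic polynomial. -/
lemma eval_trigPoly (K : ℕ) (d : ℤ → ℂ) (x : Torus) :
    (trigPoly K d).eval (phase x) = fourier (-(K : ℤ)) x * trig K d x := by
  rw [trigPoly, trig, sum_Icc_eq_sum_range, Polynomial.eval_finsetSum, Finset.mul_sum]
  refine Finset.sum_congr rfl fun j _ => ?_
  have h : fourier (-(j : ℤ)) x = fourier (-(K : ℤ)) x * (fourier (-((j : ℤ) - K)) x : ℂ) := by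
    rw [← fourier_add]; congr 2; ring
  rw [Polynomial.eval_mul, Polynomial.eval_C, Polynomial.eval_pow, Polynomial.eval_X,
    ← fourier_neg_natCast, h]
  ring

lemma eval_trigPoly_eq_zero_iff {K : ℕ} {d : ℤ → ℂ} {x : Torus} :
    (trigPoly K d).eval (phase x) = 0 ↔ trig K d x = 0 := by
  rw [eval_trigPoly, mul_eq_zero, or_iff_right (fourier_ne_zero _ _)]

lemma natDegree_trigPoly_le (K : ℕ) (d : ℤ → ℂ) : (trigPoly K d).natDegree ≤ 2 * K := by
  apply Polynomial.natDegree_sum_le_of_forall_le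
  intro j hj
  exact (Polynomial.natDegree_C_mul_X_pow_le _ _).trans (by simpa [Nat.lt_succ_iff] using hj)

lemma eq_zero_of_trigPoly_eq_zero {K : ℕ} {d : ℤ → ℂ} (h : trigPoly K d = 0) {k : ℤ}
    (hk : |k| ≤ K) : d k = 0 := by
  have hk' := abs_le.1 hk
  have := congrArg (fun p => p.coeff (k + K).toNat) h
  simp only [trigPoly, Polynomial.finsetSum_coeff, Polynomial.coeff_C_mul_X_pow,
    Polynomial.coeff_zero, Finset.sum_ite_eq, Finset.mem_range] at this
  rw [if_pos (by omega)] at this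
  convert this
  omega

lemma trigPoly_eq_zero_of_trig {K : ℕ} {d : ℤ → ℂ} (h : ∀ x, trig K d x = 0) :
    trigPoly K d = 0 := by
  by_contra hne
  apply infinite_range_phase
  refine (Polynomial.finite_setOfPred_isRoot hne).subset ?_
  rintro _ ⟨x, rfl⟩
  exact eval_trigPoly_eq_zero_iff.2 (h x)

/-- The points of the torus whose phases are roots of a nonzero polynomial. -/
lemma exists_finset_eval_phase_eq_zero {P : Polynomial ℂ} (hP : P ≠ 0) :
    ∃ S : Finset Torus, S.card ≤ P.natDegree ∧ ∀ x, x ∈ S ↔ P.eval (phase x) = 0 := by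
  classical
  refine ⟨P.roots.toFinset.preimage phase phase_injective.injOn, ?_, fun x => by simp [hP]⟩
  calc _ ≤ P.roots.toFinset.card := by
        rw [← Finset.card_image_of_injective _ phase_injective]
        refine Finset.card_le_card fun z hz => ?_
        obtain ⟨x, hx, rfl⟩ := Finset.mem_image.1 hz
        exact Finset.mem_preimage.1 hx
    _ ≤ P.natDegree := (Multiset.toFinset_card_le _).trans P.card_roots'

/-- A zero of `η ≥ 0` is a minimum, so the derivative of `η(t) = e^{iKt} P(e^{-it})` vanishes there.
As `P` vanishes too, only the term containing `P'` remains, and its other factors are nonzero. -/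
lemma isRoot_derivative_of_nonneg {K : ℕ} {d : ℤ → ℂ} {η : Torus → ℝ}
    (hη : ∀ x, (η x : ℂ) = trig K d x) (hpos : ∀ x, 0 ≤ η x) {x : Torus} (hx : η x = 0) :
    (trigPoly K d).derivative.eval (phase x) = 0 := by
  obtain ⟨t, rfl⟩ := QuotientAddGroup.mk_surjective x
  set P := trigPoly K d
  have hP0 : P.eval (phase (t : Torus)) = 0 := by
    rw [eval_trigPoly_eq_zero_iff, ← hη]; exact_mod_cast hx
  have hphase := hasDerivAt_fourier (2 * Real.pi) (-1) t
  have hK := hasDerivAt_fourier (2 * Real.pi) K t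
  have hcomp := (P.hasDerivAt (phase (t : Torus))).comp t hphase
  have hg := hK.mul hcomp
  have hfun : ((fun y : ℝ => (fourier (K : ℤ) (y : Torus) : ℂ)) *
      ((fun z => P.eval z) ∘ fun y : ℝ => (fourier (-1) (y : Torus) : ℂ))) =
      fun s : ℝ => ((η (s : Torus) : ℝ) : ℂ) := by
    funext s
    have h1 : (fourier (K : ℤ) (s : Torus) : ℂ) * fourier (-(K : ℤ)) (s : Torus) = 1 := by
      rw [← fourier_add]; simp
    have h2 := eval_trigPoly K d (s : Torus)
    rw [phase] at h2
    rw [Pi.mul_apply, Function.comp_apply, h2, ← mul_assoc, h1, one_mul, hη]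
  rw [hfun] at hg
  simp only [Function.comp_apply] at hg
  rw [show Polynomial.eval (fourier (-1) (t : Torus)) P = 0 from hP0, mul_zero, zero_add] at hg
  have hre := Complex.reCLM.hasFDerivAt.comp_hasDerivAt t hg
  have him := Complex.imCLM.hasFDerivAt.comp_hasDerivAt t hg
  have hmin : IsLocalMin (fun s : ℝ => η (s : Torus)) t :=
    Filter.Eventually.of_forall fun s => by
      change η (t : Torus) ≤ _
      rw [show η (t : Torus) = 0 from hx]; exact hpos _
  have hre0 := hmin.hasDerivAt_eq_zero hre
  -- The imaginary part is constantly zero because `η` is real.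
  have him0 := him.unique (by
    simpa [Function.comp_def] using hasDerivAt_const t (0 : ℝ))
  have h0 := Complex.ext (z := _) (w := 0) hre0 him0
  have hne : (2 * Real.pi * Complex.I * ((-1 : ℤ) : ℂ) / ((2 * Real.pi : ℝ) : ℂ) *
      fourier (-1) (t : Torus)) ≠ 0 := by
    have hpi : (Real.pi : ℂ) ≠ 0 := by exact_mod_cast Real.pi_ne_zero
    simp [hpi, Complex.I_ne_zero]
  rcases mul_eq_zero.1 h0 with h | h
  · exact absurd h (fourier_ne_zero _ _)
  · exact (mul_eq_zero.1 h).resolve_right hne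

/-- A nonnegative nonzero trigonometric polynomial of degree at most `K` has at most `K` zeros. -/
lemma exists_finset_zeros_of_nonneg {K : ℕ} {d : ℤ → ℂ} {η : Torus → ℝ}
    (hη : ∀ x, (η x : ℂ) = trig K d x) (hpos : ∀ x, 0 ≤ η x) (hne : ∃ x, η x ≠ 0) :
    ∃ S : Finset Torus, S.card ≤ K ∧ ∀ x, x ∈ S ↔ η x = 0 := by
  classical
  have hP : trigPoly K d ≠ 0 := by
    obtain ⟨x, hx⟩ := hne
    intro h
    apply hx
    have := eval_trigPoly_eq_zero_iff.1
      (show (trigPoly K d).eval (phase x) = 0 by rw [h, Polynomial.eval_zero])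
    rw [← hη] at this
    exact_mod_cast this
  obtain ⟨S, -, hS⟩ := exists_finset_eval_phase_eq_zero hP
  have hS' : ∀ x, x ∈ S ↔ η x = 0 := fun x => by
    rw [hS, eval_trigPoly_eq_zero_iff, ← hη]; norm_cast
  refine ⟨S, ?_, hS'⟩
  -- Each zero counts at least twice among the at most `2K` roots.
  have hmult : ∀ x ∈ S, 2 ≤ (trigPoly K d).roots.count (phase x) := by
    intro x hx
    rw [Polynomial.count_roots]
    exact (Polynomial.one_lt_rootMultiplicity_iff_isRoot hP).2
      ⟨(hS x).1 hx, isRoot_derivative_of_nonneg hη hpos ((hS' x).1 hx)⟩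
  have h1 : S.card * 2 ≤ ∑ x ∈ S, (trigPoly K d).roots.count (phase x) := by
    rw [← smul_eq_mul]
    exact Finset.card_nsmul_le_sum _ _ _ hmult
  have h2 : ∑ x ∈ S, (trigPoly K d).roots.count (phase x) ≤ (trigPoly K d).roots.card := by
    rw [← Finset.sum_image (f := fun z => (trigPoly K d).roots.count z)
      (phase_injective.injOn), ← Multiset.toFinset_sum_count_eq]
    apply Finset.sum_le_sum_of_subset
    intro z hz
    obtain ⟨x, hx, rfl⟩ := Finset.mem_image.1 hz
    rw [Multiset.mem_toFinset, ← Multiset.one_le_count_iff_mem]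
    exact le_trans (by norm_num) (hmult x hx)
  have h3 := (Polynomial.card_roots' (trigPoly K d)).trans (natDegree_trigPoly_le K d)
  omega

/-! ### Moment vectors and the dual trigonometric polynomial. -/

/-- The moment vectors of order less than `N` of at most `N` points are linearly independent. -/
lemma eq_zero_of_sum_mul_phase_pow {n N : ℕ} (hn : n ≤ N) {x : Fin n → Torus}
    (hx : Function.Injective x) {u : Fin n → ℂ}
    (h : ∀ j < N, ∑ i, u i * phase (x i) ^ j = 0) : u = 0 :=
  Matrix.eq_zero_of_forall_pow_sum_mul_pow_eq_zero (phase_injective.comp hx)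
    fun i => h i (i.2.trans_le hn)

lemma eq_zero_of_finset_sum_mul_phase_pow {N : ℕ} {S : Finset Torus} (hS : S.card ≤ N)
    {u : Torus → ℂ} (h : ∀ j < N, ∑ s ∈ S, u s * phase s ^ j = 0) : ∀ s ∈ S, u s = 0 := by
  intro s hs
  let e := S.equivFin
  have := eq_zero_of_sum_mul_phase_pow hS (x := fun i => e.symm i) (u := fun i => u (e.symm i))
    (Subtype.val_injective.comp e.symm.injective) fun j hj => by
      rw [Equiv.sum_comp e.symm fun s : S => u s * phase s ^ j,
        Finset.sum_coe_sort S fun s => u s * phase s ^ j]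
      exact h j hj
  simpa using congrFun this (e ⟨s, hs⟩)

/-- A real linear functional on conjugate-symmetric vectors has a complex linear expression. -/
lemma exists_coeff_of_real_functional (K : ℕ)
    (g : (Finset.Icc (-(K : ℤ)) K → ℂ) →ₗ[ℝ] ℝ) :
    ∃ d : ℤ → ℂ, ∀ v : ℤ → ℂ, (∀ k : ℤ, |k| ≤ (K : ℤ) → v (-k) = conj (v k)) →
      (g (fun k => v k) : ℂ) = ∑ k ∈ Finset.Icc (-(K : ℤ)) K, d k * v k := by
  classical
  let A : ℤ → ℝ := fun k => if hk : k ∈ Finset.Icc (-(K : ℤ)) K then g (Pi.single ⟨k, hk⟩ 1) else 0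
  let B : ℤ → ℝ := fun k =>
    if hk : k ∈ Finset.Icc (-(K : ℤ)) K then g (Pi.single ⟨k, hk⟩ Complex.I) else 0
  -- With this `c`, the `k`-th contribution to `g` is the real part of `c k * v k`. Symmetrising the
  -- coefficients removes the real part on conjugate-symmetric `v`.
  let c : ℤ → ℂ := fun k => A k - Complex.I * B k
  refine ⟨fun k => (c k + conj (c (-k))) / 2, fun v hv => ?_⟩
  have h1 : g (fun k => v k) =
      ∑ k ∈ Finset.Icc (-(K : ℤ)) K, ((v k).re * A k + (v k).im * B k) := by
    have hdec : (fun k : Finset.Icc (-(K : ℤ)) K => v k) =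
        ∑ k : Finset.Icc (-(K : ℤ)) K, ((v k).re • Pi.single (M := fun _ => ℂ) k 1 +
          (v k).im • Pi.single (M := fun _ => ℂ) k Complex.I) := by
      funext j
      simp [Finset.sum_apply, Pi.single_apply, Finset.sum_add_distrib]
    rw [hdec, map_sum, ← Finset.sum_coe_sort (Finset.Icc (-(K : ℤ)) K)]
    refine Finset.sum_congr rfl fun k _ => ?_
    have hA : A k = g (Pi.single k 1) := dif_pos k.2
    have hB : B k = g (Pi.single k Complex.I) := dif_pos k.2
    rw [map_add, map_smul, map_smul, hA, hB, smul_eq_mul, smul_eq_mul]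
  have h2 : ∀ k ∈ Finset.Icc (-(K : ℤ)) K, (((v k).re * A k + (v k).im * B k : ℝ) : ℂ) =
      (c k * v k + conj (c k) * v (-k)) / 2 := by
    intro k hk
    rw [hv k (abs_le.2 (Finset.mem_Icc.1 hk))]
    apply Complex.ext <;> simp [c] <;> ring
  have h3 : ∑ k ∈ Finset.Icc (-(K : ℤ)) K, conj (c k) * v (-k) =
      ∑ k ∈ Finset.Icc (-(K : ℤ)) K, conj (c (-k)) * v k := by
    apply Finset.sum_bij' (fun k _ => -k) (fun k _ => -k)
    all_goals
      intros
      simp only [Finset.mem_Icc, neg_neg] at *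
      try omega
  rw [h1, Complex.ofReal_sum, Finset.sum_congr rfl h2, ← Finset.sum_div, Finset.sum_add_distrib, h3,
    ← Finset.sum_add_distrib, Finset.sum_div]
  exact Finset.sum_congr rfl fun k _ => by ring

lemma fourier_conj_symm (x : Torus) (k : ℤ) :
    (fourier (-(-k)) x : ℂ) = conj (fourier (-k) x) := fourier_neg

/-- Conjugate-symmetric sequences are real combinations of the moment sequences of points. -/
lemma mem_span_range_fourier {K : ℕ} {y : ℤ → ℂ}
    (hy : ∀ k : ℤ, |k| ≤ (K : ℤ) → y (-k) = conj (y k)) :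
    (fun k : Finset.Icc (-(K : ℤ)) K => y k) ∈ Submodule.span ℝ
      (Set.range fun (x : Torus) (k : Finset.Icc (-(K : ℤ)) K) => (fourier (-(k : ℤ)) x : ℂ)) := by
  by_contra hmem
  -- A functional killing every moment vector is an identically zero trigonometric polynomial; its
  -- coefficients vanish, hence so does its value at `y`.
  obtain ⟨g, hg, hker⟩ := Submodule.exists_le_ker_of_notMem hmem
  obtain ⟨d, hd⟩ := exists_coeff_of_real_functional K g
  have hzero : trigPoly K d = 0 := by
    refine trigPoly_eq_zero_of_trig fun x => ?_
    have h1 := hd (fun k => fourier (-k) x) fun k _ => fourier_conj_symm x k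
    rw [trig, ← h1]
    exact_mod_cast hker (Submodule.subset_span ⟨x, rfl⟩)
  apply hg
  have h2 := hd y hy
  rw [Finset.sum_eq_zero fun k hk => by
    rw [eq_zero_of_trigPoly_eq_zero hzero (abs_le.2 (Finset.mem_Icc.1 hk)), zero_mul]] at h2
  exact_mod_cast h2

/-- Every conjugate-symmetric sequence is the moment sequence of a discrete measure whose norm is
certified to be minimal by a real trigonometric polynomial bounded by one. -/
theorem exists_trig_certificate {K : ℕ} {y : ℤ → ℂ}
    (hy : ∀ k : ℤ, |k| ≤ (K : ℤ) → y (-k) = conj (y k)) :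
    ∃ (d : ℤ → ℂ) (η : Torus → ℝ) (n : ℕ) (a : Fin n → ℝ) (x : Fin n → Torus),
      (∀ x, (η x : ℂ) = trig K d x) ∧ (∀ x, |η x| ≤ 1) ∧
      (∀ k : ℤ, |k| ≤ (K : ℤ) → ∑ i, (a i : ℂ) * fourier (-k) (x i) = y k) ∧
      ((∑ i, |a i| : ℝ) : ℂ) = ∑ k ∈ Finset.Icc (-(K : ℤ)) K, d k * y k := by
  obtain ⟨g, n, a, x, h1, h2, h3⟩ := exists_dual_certificate
    (φ := fun (x : Torus) (k : Finset.Icc (-(K : ℤ)) K) => (fourier (-(k : ℤ)) x : ℂ))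
    (by fun_prop) (mem_span_range_fourier hy)
  obtain ⟨d, hd⟩ := exists_coeff_of_real_functional K g
  refine ⟨d, fun x => g fun k => fourier (-(k : ℤ)) x, n, a, x, fun x => ?_, h1, fun k hk => ?_, ?_⟩
  · exact hd (fun k => fourier (-k) x) fun k _ => fourier_conj_symm x k
  · have := congrFun h2 ⟨k, Finset.mem_Icc.2 (abs_le.1 hk)⟩
    simpa [Finset.sum_apply] using this
  · rw [← h3]
    exact hd y hy

/-! ### Integration against signed measures and the total-variation norm. -/

/-- The positive part of the Jordan decomposition. -/
noncomputable abbrev pos (w : RadonMeasure) : Measure Torus := w.toJordanDecomposition.posPart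

/-- The negative part of the Jordan decomposition. -/
noncomputable abbrev neg (w : RadonMeasure) : Measure Torus := w.toJordanDecomposition.negPart

/-- The integral of a complex function against a signed measure. -/
noncomputable def integralC (w : RadonMeasure) (f : Torus → ℂ) : ℂ :=
  VectorMeasure.integral w f (ContinuousLinearMap.lsmul ℝ ℝ).flip

lemma fourierCoefficient_eq (w : RadonMeasure) (k : ℤ) :
    fourierCoefficient w k = integralC w fun x => fourier (-k) x := rfl

lemma integrable_of_continuous {E : Type*} [NormedAddCommGroup E] {f : Torus → E}
    (hf : Continuous f) (μ : Measure Torus) [IsFiniteMeasure μ] : Integrable f μ :=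
  hf.integrable_of_hasCompactSupport (HasCompactSupport.of_compactSpace f)

instance (w : RadonMeasure) : IsFiniteMeasure w.variation := by
  rw [← SignedMeasure.totalVariation_eq_variation]
  unfold SignedMeasure.totalVariation
  infer_instance

lemma eq_pos_sub_neg (w : RadonMeasure) :
    w = (pos w).toSignedMeasure - (neg w).toSignedMeasure :=
  (SignedMeasure.toSignedMeasure_toJordanDecomposition w).symm

lemma integralC_eq_sub (w : RadonMeasure) {f : Torus → ℂ} (hf : Continuous f) :
    integralC w f = ∫ x, f x ∂pos w - ∫ x, f x ∂neg w := by
  conv_lhs => rw [eq_pos_sub_neg w]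
  rw [integralC, VectorMeasure.integral_sub_vectorMeasure (integrable_of_continuous hf _)
    (integrable_of_continuous hf _), VectorMeasure.integral_toSignedMeasure,
    VectorMeasure.integral_toSignedMeasure]

lemma integralC_add (w v : RadonMeasure) {f : Torus → ℂ} (hf : Continuous f) :
    integralC (w + v) f = integralC w f + integralC v f :=
  VectorMeasure.integral_add_vectorMeasure (integrable_of_continuous hf _)
    (integrable_of_continuous hf _)

lemma integralC_neg (w : RadonMeasure) (f : Torus → ℂ) :
    integralC (-w) f = -integralC w f :=
  VectorMeasure.integral_neg_vectorMeasure

lemma integralC_dirac (s : Torus) (a : ℝ) (f : Torus → ℂ) :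
    integralC (VectorMeasure.dirac s a) f = a * f s := by
  rw [integralC, VectorMeasure.integral_dirac]
  simp

lemma integralC_sum_dirac {ι : Type*} (S : Finset ι) (x : ι → Torus) (a : ι → ℝ) {f : Torus → ℂ}
    (hf : Continuous f) :
    integralC (∑ i ∈ S, VectorMeasure.dirac (x i) (a i)) f = ∑ i ∈ S, a i * f (x i) := by
  rw [integralC, VectorMeasure.integral_finsetSum_vectorMeasure
    fun i _ => integrable_of_continuous hf _]
  exact Finset.sum_congr rfl fun i _ => integralC_dirac _ _ _

lemma integralC_sum_mul {ι : Type*} (w : RadonMeasure) (S : Finset ι) (c : ι → ℂ)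
    (f : ι → Torus → ℂ) (hf : ∀ i, Continuous (f i)) :
    integralC w (fun x => ∑ i ∈ S, c i * f i x) = ∑ i ∈ S, c i * integralC w (f i) := by
  rw [integralC_eq_sub w (by fun_prop), integral_finsetSum, integral_finsetSum,
    ← Finset.sum_sub_distrib]
  · refine Finset.sum_congr rfl fun i _ => ?_
    rw [integral_const_mul, integral_const_mul, integralC_eq_sub w (hf i), mul_sub]
  · exact fun i _ => integrable_of_continuous (by have := hf i; fun_prop) _
  · exact fun i _ => integrable_of_continuous (by have := hf i; fun_prop) _

lemma integralC_ofReal (w : RadonMeasure) {f : Torus → ℝ} (hf : Continuous f) :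
    integralC w (fun x => (f x : ℂ)) = ((∫ x, f x ∂pos w - ∫ x, f x ∂neg w : ℝ) : ℂ) := by
  rw [integralC_eq_sub w (by fun_prop), integral_complex_ofReal, integral_complex_ofReal, Complex.ofReal_sub]

lemma integralC_trig (w : RadonMeasure) (K : ℕ) (d : ℤ → ℂ) :
    integralC w (trig K d) = ∑ k ∈ Finset.Icc (-(K : ℤ)) K, d k * fourierCoefficient w k :=
  integralC_sum_mul w _ d (fun k x => fourier (-k) x) fun k => by fun_prop

lemma tvNorm_eq (w : RadonMeasure) : tvNorm w = (pos w).real Set.univ + (neg w).real Set.univ := by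
  rw [tvNorm, SignedMeasure.totalVariation, measureReal_add_apply]

lemma tvNorm_neg (w : RadonMeasure) : tvNorm (-w) = tvNorm w := by
  rw [tvNorm, SignedMeasure.totalVariation_neg, tvNorm]

/-- Only an inequality, since the points may coincide; the certificate supplies the other direction.
-/
lemma tvNorm_diracSum_le {n : ℕ} (a : Fin n → ℝ) (x : Fin n → Torus) :
    tvNorm (diracSum a x) ≤ ∑ i, |a i| := by
  have h : ∀ S : Finset (Fin n),
      (∑ i ∈ S, VectorMeasure.dirac (x i) (a i)).variation Set.univ ≤ ∑ i ∈ S, ‖a i‖ₑ := by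
    classical
    intro S
    induction S using Finset.induction_on with
    | empty => simp
    | insert i S hi ih =>
      rw [Finset.sum_insert hi, Finset.sum_insert hi]
      refine (VectorMeasure.variation_add_le Set.univ).trans ?_
      rw [Measure.add_apply]
      refine add_le_add ?_ ih
      simp
  rw [tvNorm, SignedMeasure.totalVariation_eq_variation, Measure.real, diracSum]
  refine (ENNReal.toReal_mono ?_ (h Finset.univ)).trans_eq ?_
  · simp
  · rw [ENNReal.toReal_sum (by simp)]
    simp

/-! ### Complementary slackness. -/

/-- Minimality is certified by a real trigonometric polynomial bounded by one, which equals `1`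
on the positive part and `-1` on the negative part of every solution. -/
theorem exists_certificate {K : ℕ} {y : ℤ → ℂ}
    (hy : ∀ k : ℤ, |k| ≤ (K : ℤ) → y (-k) = conj (y k)) :
    ∃ (d : ℤ → ℂ) (η : Torus → ℝ),
      (∀ x, (η x : ℂ) = trig K d x) ∧ (∀ x, |η x| ≤ 1) ∧ (solutionSet K y).Nonempty ∧
      ∀ w ∈ solutionSet K y, (∀ᵐ x ∂pos w, η x = 1) ∧ ∀ᵐ x ∂neg w, η x = -1 := by
  obtain ⟨d, η, n, a, x, hη, hη1, hax, hd⟩ := exists_trig_certificate hy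
  have hcont : Continuous η := by
    have : η = fun x => (trig K d x).re := by
      funext x; rw [← hη, Complex.ofReal_re]
    rw [this]
    exact Complex.continuous_re.comp (continuous_trig K d)
  -- The integral of `η` involves only frequencies at most `K`, so it is the same for all feasible
  -- measures.
  have hpair : ∀ v ∈ feasibleSet K y,
      ∑ i, |a i| = ∫ x, η x ∂pos v - ∫ x, η x ∂neg v := by
    intro v hv
    have h1 := integralC_ofReal v hcont
    rw [funext hη, integralC_trig, Finset.sum_congr rfl fun k hk => by
      rw [hv k (abs_le.2 (Finset.mem_Icc.1 hk))], ← hd] at h1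
    exact_mod_cast h1
  -- Both integrands are nonnegative, so the right side is too; for a solution it is zero, and both
  -- integrals vanish.
  have hsplit : ∀ v ∈ feasibleSet K y, ∫ x, (1 - η x) ∂pos v + ∫ x, (1 + η x) ∂neg v =
      tvNorm v - ∑ i, |a i| := by
    intro v hv
    rw [hpair v hv, tvNorm_eq, integral_sub (integrable_const _) (integrable_of_continuous hcont _),
      integral_add (integrable_const _) (integrable_of_continuous hcont _)]
    simp only [integral_const, smul_eq_mul, mul_one]
    ring
  have hn1 : ∀ x, 0 ≤ 1 - η x := fun x => by linarith [(abs_le.1 (hη1 x)).2]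
  have hn2 : ∀ x, 0 ≤ 1 + η x := fun x => by linarith [(abs_le.1 (hη1 x)).1]
  have hfeas : diracSum a x ∈ feasibleSet K y := by
    intro k hk
    rw [fourierCoefficient_eq, diracSum, integralC_sum_dirac _ _ _ (by fun_prop), hax k hk]
  refine ⟨d, η, hη, hη1, ⟨diracSum a x, hfeas, fun v hv => ?_⟩, fun w hw => ?_⟩
  · have h1 := integral_nonneg (μ := pos v) (f := fun x => 1 - η x) hn1
    have h2 := integral_nonneg (μ := neg v) (f := fun x => 1 + η x) hn2
    linarith [hsplit v hv, tvNorm_diracSum_le a x]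
  · have h1 := integral_nonneg (μ := pos w) (f := fun x => 1 - η x) hn1
    have h2 := integral_nonneg (μ := neg w) (f := fun x => 1 + η x) hn2
    have h3 := hsplit w hw.1
    have h4 := (hw.2 _ hfeas).trans (tvNorm_diracSum_le a x)
    have h5 := (integral_eq_zero_iff_of_nonneg hn1 (integrable_of_continuous (by fun_prop) _)).1
      (show ∫ x, (1 - η x) ∂pos w = 0 by linarith)
    have h6 := (integral_eq_zero_iff_of_nonneg hn2 (integrable_of_continuous (by fun_prop) _)).1
      (show ∫ x, (1 + η x) ∂neg w = 0 by linarith)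
    constructor
    · filter_upwards [h5] with x hx
      have : 1 - η x = 0 := hx
      linarith
    · filter_upwards [h6] with x hx
      have : 1 + η x = 0 := hx
      linarith

/-! ### The Toeplitz quadratic form. -/

/-- The polynomial with coefficient vector `u`. -/
noncomputable def coeffPoly {K : ℕ} (u : Fin (K + 1) → ℂ) : Polynomial ℂ :=
  ∑ j, Polynomial.C (u j) * Polynomial.X ^ (j : ℕ)

lemma eval_coeffPoly {K : ℕ} (u : Fin (K + 1) → ℂ) (z : ℂ) :
    (coeffPoly u).eval z = ∑ j, u j * z ^ (j : ℕ) := by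
  simp [coeffPoly, Polynomial.eval_finsetSum]

lemma coeff_coeffPoly {K : ℕ} (u : Fin (K + 1) → ℂ) (i : Fin (K + 1)) :
    (coeffPoly u).coeff i = u i := by
  simp [coeffPoly, Polynomial.finsetSum_coeff, Fin.val_inj]

lemma natDegree_coeffPoly_le {K : ℕ} (u : Fin (K + 1) → ℂ) : (coeffPoly u).natDegree ≤ K := by
  apply Polynomial.natDegree_sum_le_of_forall_le
  intro j _
  exact (Polynomial.natDegree_C_mul_X_pow_le _ _).trans (Nat.lt_succ_iff.1 j.2)

lemma coeffPoly_ne_zero {K : ℕ} {u : Fin (K + 1) → ℂ} (hu : u ≠ 0) : coeffPoly u ≠ 0 := by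
  contrapose! hu
  funext i
  rw [← coeff_coeffPoly u i, hu, Polynomial.coeff_zero, Pi.zero_apply]

lemma coeffPoly_coeff {K : ℕ} {P : Polynomial ℂ} (hP : P.natDegree ≤ K) :
    coeffPoly (fun j : Fin (K + 1) => P.coeff j) = P := by
  rw [coeffPoly, Fin.sum_univ_eq_sum_range fun j => Polynomial.C (P.coeff j) * Polynomial.X ^ j]
  exact (P.as_sum_range_C_mul_X_pow' (Nat.lt_succ_of_le hP)).symm

/-- A nonzero coefficient vector vanishing exactly at at most `K` given points. -/
lemma exists_coeff_vanishing {K : ℕ} {S : Finset Torus} (hS : S.card ≤ K) :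
    ∃ u : Fin (K + 1) → ℂ, u ≠ 0 ∧ ∀ x, (coeffPoly u).eval (phase x) = 0 ↔ x ∈ S := by
  set P : Polynomial ℂ := ∏ s ∈ S, (Polynomial.X - Polynomial.C (phase s)) with hP
  have hdeg : P.natDegree ≤ K := by
    rw [hP, Polynomial.natDegree_finsetProd_X_sub_C_eq_card]; exact hS
  have hP0 : P ≠ 0 := Finset.prod_ne_zero_iff.2 fun s _ => Polynomial.X_sub_C_ne_zero _
  refine ⟨fun j => P.coeff j, fun h => hP0 ?_, fun x => ?_⟩
  · rw [← coeffPoly_coeff hdeg, h]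
    simp [coeffPoly]
  · rw [coeffPoly_coeff hdeg, hP, Polynomial.eval_prod, Finset.prod_eq_zero_iff]
    constructor
    · rintro ⟨s, hs, h⟩
      rw [Polynomial.eval_sub, Polynomial.eval_X, Polynomial.eval_C, sub_eq_zero] at h
      rwa [phase_injective h]
    · exact fun h => ⟨x, h, by simp⟩

lemma continuous_phase : Continuous phase := by
  unfold phase
  fun_prop

lemma continuous_norm_sq_eval (P : Polynomial ℂ) :
    Continuous fun x : Torus => ‖P.eval (phase x)‖ ^ 2 :=
  ((P.continuous.comp continuous_phase).norm).pow 2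

/-- The Toeplitz quadratic form of the moments of `w` is integration of squared moduli. -/
lemma star_dotProduct_toeplitz_eq_integralC {K : ℕ} {y : ℤ → ℂ} {w : RadonMeasure}
    (hw : w ∈ feasibleSet K y) (u : Fin (K + 1) → ℂ) :
    star u ⬝ᵥ ((toeplitz K y).mulVec u) =
      integralC w fun x => ((‖(coeffPoly u).eval (phase x)‖ ^ 2 : ℝ) : ℂ) := by
  -- The expansion of `|p_u|²` has frequencies `j - i` between `-K` and `K`, exactly those
  -- prescribed by the constraints.
  have hexp : (fun x : Torus => ((‖(coeffPoly u).eval (phase x)‖ ^ 2 : ℝ) : ℂ)) =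
      fun x => ∑ p : Fin (K + 1) × Fin (K + 1), (conj (u p.1) * u p.2) *
        fourier (-((p.2 : ℤ) - (p.1 : ℤ))) x := by
    funext x
    rw [Complex.ofReal_pow, ← Complex.conj_mul', eval_coeffPoly, map_sum, Finset.sum_mul_sum,
      ← Finset.univ_product_univ, Finset.sum_product]
    refine Finset.sum_congr rfl fun i _ => Finset.sum_congr rfl fun j _ => ?_
    have h := fourier_neg_sub_natCast i j x
    rw [h, map_mul]
    ring
  rw [hexp, integralC_sum_mul w _ _ _ fun p => by fun_prop, ← Finset.univ_product_univ,
    Finset.sum_product]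
  simp only [dotProduct, Matrix.mulVec, Finset.mul_sum]
  refine Finset.sum_congr rfl fun i _ => Finset.sum_congr rfl fun j _ => ?_
  rw [← fourierCoefficient_eq, hw _ (by rw [abs_le]; omega)]
  simp only [toeplitz, Matrix.of_apply, Pi.star_apply, RCLike.star_def]
  ring

lemma star_dotProduct_toeplitz {K : ℕ} {y : ℤ → ℂ} {w : RadonMeasure} (hw : w ∈ feasibleSet K y)
    (u : Fin (K + 1) → ℂ) :
    star u ⬝ᵥ ((toeplitz K y).mulVec u) =
      ((∫ x, ‖(coeffPoly u).eval (phase x)‖ ^ 2 ∂pos w -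
        ∫ x, ‖(coeffPoly u).eval (phase x)‖ ^ 2 ∂neg w : ℝ) : ℂ) := by
  rw [star_dotProduct_toeplitz_eq_integralC hw, integralC_ofReal w (continuous_norm_sq_eval _)]

lemma star_dotProduct_toeplitz_of_diracSum {K : ℕ} {y : ℤ → ℂ} {n : ℕ} {a : Fin n → ℝ}
    {x : Fin n → Torus} (hw : diracSum a x ∈ feasibleSet K y) (u : Fin (K + 1) → ℂ) :
    star u ⬝ᵥ ((toeplitz K y).mulVec u) =
      ((∑ i, a i * ‖(coeffPoly u).eval (phase (x i))‖ ^ 2 : ℝ) : ℂ) := by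
  have hcont : Continuous fun x : Torus => ((‖(coeffPoly u).eval (phase x)‖ ^ 2 : ℝ) : ℂ) :=
    Complex.continuous_ofReal.comp (continuous_norm_sq_eval _)
  rw [star_dotProduct_toeplitz_eq_integralC hw, diracSum, integralC_sum_dirac _ _ _ hcont]
  push_cast
  rfl

/-! ### Measures concentrated on finite sets. -/

lemma ae_totalVariation_iff {w : RadonMeasure} {p : Torus → Prop} :
    (∀ᵐ x ∂w.totalVariation, p x) ↔ (∀ᵐ x ∂pos w, p x) ∧ ∀ᵐ x ∂neg w, p x :=
  ae_add_measure_iff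

lemma real_eq_sum_of_ae_mem {μ : Measure Torus} [IsFiniteMeasure μ] {S : Finset Torus}
    (h : ∀ᵐ x ∂μ, x ∈ S) (E : Set Torus) :
    μ.real E = ∑ s ∈ S, E.indicator (fun s => μ.real {s}) s := by
  classical
  have h1 : μ.real E = μ.real (S.filter (· ∈ E) : Finset Torus) := by
    apply measureReal_congr
    filter_upwards [h] with x hx
    apply propext
    change x ∈ E ↔ x ∈ ((S.filter (· ∈ E) : Finset Torus) : Set Torus)
    simp [hx]
  rw [h1, ← sum_measureReal_singleton, Finset.sum_filter]
  rfl

/-- A signed measure concentrated on a finite set is a sum of Dirac masses. -/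
lemma eq_sum_dirac {w : RadonMeasure} {S : Finset Torus} (h : ∀ᵐ x ∂w.totalVariation, x ∈ S) :
    w = ∑ s ∈ S, VectorMeasure.dirac s (w {s}) := by
  classical
  obtain ⟨hp, hn⟩ := ae_totalVariation_iff.1 h
  ext E hE
  rw [w.apply_eq_posPart_real_sub_negPart_real hE, real_eq_sum_of_ae_mem hp,
    real_eq_sum_of_ae_mem hn, ← Finset.sum_sub_distrib, FunLike.coe_sum,
    Finset.sum_apply]
  refine Finset.sum_congr rfl fun s _ => ?_
  by_cases hs : s ∈ E
  · rw [VectorMeasure.dirac_apply_of_mem hE hs, Set.indicator_of_mem hs, Set.indicator_of_mem hs,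
      w.apply_eq_posPart_real_sub_negPart_real (measurableSet_singleton s)]
  · rw [VectorMeasure.dirac_apply_of_notMem hs, Set.indicator_of_notMem hs,
      Set.indicator_of_notMem hs, sub_zero]

lemma diracSum_apply_singleton {n : ℕ} {a : Fin n → ℝ} {x : Fin n → Torus}
    (hx : Function.Injective x) (i : Fin n) : diracSum a x {x i} = a i := by
  rw [diracSum, FunLike.coe_sum, Finset.sum_apply, Finset.sum_eq_single i]
  · exact VectorMeasure.dirac_apply_of_mem (measurableSet_singleton _) rfl
  · exact fun j _ hj => VectorMeasure.dirac_apply_of_notMem fun h => hj (hx h)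
  · simp

lemma diracSum_apply_singleton_of_notMem {n : ℕ} (a : Fin n → ℝ) {x : Fin n → Torus}
    {s : Torus} (hs : s ∉ Set.range x) : diracSum a x {s} = 0 := by
  rw [diracSum, FunLike.coe_sum, Finset.sum_apply]
  exact Finset.sum_eq_zero fun j _ =>
    VectorMeasure.dirac_apply_of_notMem fun h => hs ⟨j, h⟩

lemma exists_isComposedOf {w : RadonMeasure} {S : Finset Torus}
    (h : ∀ᵐ x ∂w.totalVariation, x ∈ S) :
    ∃ n ≤ S.card, ∃ (a : Fin n → ℝ) (x : Fin n → Torus), IsComposedOf w a x := by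
  classical
  -- Points carrying no mass are dropped to make all weights nonzero; hence only a bound on `n`.
  set S' := S.filter fun s => w {s} ≠ 0
  let e := S'.equivFin
  refine ⟨S'.card, Finset.card_filter_le _ _, fun i => w {(e.symm i : Torus)},
    fun i => e.symm i, Subtype.val_injective.comp e.symm.injective,
    fun i => (Finset.mem_filter.1 (e.symm i).2).2, ?_⟩
  rw [diracSum, Equiv.sum_comp e.symm fun s : S' => VectorMeasure.dirac (s : Torus) (w {(s : Torus)}),
    Finset.sum_coe_sort S' fun s => VectorMeasure.dirac s (w {s})]
  conv_lhs => rw [eq_sum_dirac h]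
  symm
  apply Finset.sum_subset (Finset.filter_subset _ _)
  intro s hs hs'
  have : w {s} = 0 := by simpa [S', hs] using hs'
  rw [this, VectorMeasure.dirac_zero]

lemma IsComposedOf.apply_singleton {w : RadonMeasure} {n : ℕ} {a : Fin n → ℝ} {x : Fin n → Torus}
    (h : IsComposedOf w a x) (i : Fin n) : w {x i} = a i := by
  rw [h.eq_diracSum, diracSum_apply_singleton h.injective]

/-- Measures concentrated on a common set of at most `2K + 1` points are determined by their
Fourier coefficients of order at most `K`. -/
lemma eq_of_mem_feasibleSet {K : ℕ} {y : ℤ → ℂ} {w v : RadonMeasure} (hw : w ∈ feasibleSet K y)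
    (hv : v ∈ feasibleSet K y) {S : Finset Torus} (hS : S.card ≤ 2 * K + 1)
    (hwS : ∀ᵐ x ∂w.totalVariation, x ∈ S) (hvS : ∀ᵐ x ∂v.totalVariation, x ∈ S) : w = v := by
  have hcoef : ∀ (m : RadonMeasure), (∀ᵐ x ∂m.totalVariation, x ∈ S) → m ∈ feasibleSet K y →
      ∀ k : ℤ, |k| ≤ K → ∑ s ∈ S, (m {s} : ℂ) * fourier (-k) s = y k := by
    intro m hm hmf k hk
    rw [← hmf k hk, fourierCoefficient_eq]
    conv_rhs => rw [eq_sum_dirac hm]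
    exact (integralC_sum_dirac S (fun s => s) (fun s => m {s}) (by fun_prop)).symm
  -- The factor `e^{iKs}` in the unknowns turns the frequencies `-K, …, K` into the powers `0, …,
  -- 2K` of a Vandermonde system.
  have hzero := eq_zero_of_finset_sum_mul_phase_pow hS
    (u := fun s => ((w {s} : ℂ) - v {s}) * fourier (K : ℤ) s) fun j hj => by
      have hk : |(j : ℤ) - K| ≤ K := by rw [abs_le]; omega
      have h1 := hcoef w hwS hw _ hk
      have h2 := hcoef v hvS hv _ hk
      rw [← sub_eq_zero.2 (h1.trans h2.symm), ← Finset.sum_sub_distrib]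
      refine Finset.sum_congr rfl fun s _ => ?_
      have h3 : (fourier (-((j : ℤ) - K)) s : ℂ) = fourier (K : ℤ) s * phase s ^ j := by
        rw [← fourier_neg_natCast, ← fourier_add]; congr 2; ring
      rw [h3]; ring
  rw [eq_sum_dirac hwS, eq_sum_dirac hvS]
  refine Finset.sum_congr rfl fun s hs => ?_
  have h := (mul_eq_zero.1 (hzero s hs)).resolve_right (fourier_ne_zero _ _)
  rw [show w {s} = v {s} by exact_mod_cast sub_eq_zero.1 h]

lemma trig_const_sub (K : ℕ) (c : ℂ) (d : ℤ → ℂ) (x : Torus) :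
    trig K (fun k => (if k = 0 then c else 0) - d k) x = c - trig K d x := by
  simp [trig, sub_mul, Finset.sum_sub_distrib, ite_mul]

/-- The points where a nonconstant trigonometric polynomial of degree `K` reaches its
maximum. -/
lemma exists_finset_eq_max {K : ℕ} {d : ℤ → ℂ} {η : Torus → ℝ}
    (hη : ∀ x, (η x : ℂ) = trig K d x) {c : ℝ} (hle : ∀ x, η x ≤ c) (hne : ∃ x, η x ≠ c) :
    ∃ S : Finset Torus, S.card ≤ K ∧ ∀ x, x ∈ S ↔ η x = c := by
  obtain ⟨S, hS, h⟩ := exists_finset_zeros_of_nonneg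
    (d := fun k => (if k = 0 then (c : ℂ) else 0) - d k) (η := fun x => c - η x)
    (fun x => by rw [trig_const_sub, ← hη, Complex.ofReal_sub]) (fun x => sub_nonneg.2 (hle x))
    (by simpa [sub_eq_zero, eq_comm] using hne)
  exact ⟨S, hS, fun x => by rw [h, sub_eq_zero, eq_comm]⟩

/-- The points where a nonconstant trigonometric polynomial of degree `K` reaches its
minimum. -/
lemma exists_finset_eq_min {K : ℕ} {d : ℤ → ℂ} {η : Torus → ℝ}
    (hη : ∀ x, (η x : ℂ) = trig K d x) {c : ℝ} (hle : ∀ x, c ≤ η x) (hne : ∃ x, η x ≠ c) :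
    ∃ S : Finset Torus, S.card ≤ K ∧ ∀ x, x ∈ S ↔ η x = c := by
  obtain ⟨S, hS, h⟩ := exists_finset_eq_max (K := K) (d := fun k => -d k) (η := fun x => -η x)
    (c := -c) (fun x => by simp [trig, hη]) (fun x => neg_le_neg (hle x)) (by simpa using hne)
  exact ⟨S, hS, fun x => by rw [h, neg_inj]⟩

lemma eq_zero_of_ae_false {μ : Measure Torus} (h : ∀ᵐ _ ∂μ, False) : μ = 0 := by
  rwa [Filter.eventually_false_iff_eq_bot, ae_eq_bot] at h

lemma integral_norm_sq_eq_zero_iff {μ : Measure Torus} [IsFiniteMeasure μ] {P : Polynomial ℂ} :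
    ∫ x, ‖P.eval (phase x)‖ ^ 2 ∂μ = 0 ↔ ∀ᵐ x ∂μ, P.eval (phase x) = 0 := by
  rw [integral_eq_zero_iff_of_nonneg (fun x => by positivity)
    (integrable_of_continuous (continuous_norm_sq_eval P) μ)]
  refine Filter.eventually_congr (Filter.Eventually.of_forall fun x => ?_)
  simp

/-! ### The positive semidefinite case. -/

/-- If the Toeplitz matrix is positive semidefinite, the solutions are positive measures. -/
theorem neg_eq_zero_of_posSemidef {K : ℕ} {y : ℤ → ℂ}
    (hy : ∀ k : ℤ, |k| ≤ (K : ℤ) → y (-k) = conj (y k)) (hT : (toeplitz K y).PosSemidef)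
    {w : RadonMeasure} (hw : w ∈ solutionSet K y) : neg w = 0 := by
  obtain ⟨d, η, hη, hη1, -, hsol⟩ := exists_certificate hy
  obtain ⟨hp, hn⟩ := hsol w hw
  apply eq_zero_of_ae_false
  by_cases hne : ∃ x, η x ≠ 1
  · obtain ⟨S, hS, hSη⟩ := exists_finset_eq_max hη (fun x => (abs_le.1 (hη1 x)).2) hne
    -- Since `p_u` vanishes exactly on `{η = 1}`, the positive part contributes nothing to the form.
    -- Semidefiniteness then puts the negative part on `{η = 1}`, while it already lives on `{η =
    -- -1}`.
    obtain ⟨u, -, hu⟩ := exists_coeff_vanishing hS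
    have h1 : ∫ x, ‖(coeffPoly u).eval (phase x)‖ ^ 2 ∂pos w = 0 := by
      rw [integral_norm_sq_eq_zero_iff]
      filter_upwards [hp] with x hx using (hu x).2 ((hSη x).2 hx)
    have h2 := hT.dotProduct_mulVec_nonneg u
    rw [star_dotProduct_toeplitz hw.1, h1, zero_sub, Complex.zero_le_real, neg_nonneg] at h2
    have h3 := integral_norm_sq_eq_zero_iff.1 (h2.antisymm (integral_nonneg fun x => by positivity))
    filter_upwards [h3, hn] with x hx hx'
    rw [hu, hSη] at hx
    linarith
  · push Not at hne
    filter_upwards [hn] with x hx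
    rw [hne] at hx
    norm_num at hx

lemma pos_real_sub_neg_real {K : ℕ} {y : ℤ → ℂ} {w : RadonMeasure} (hw : w ∈ feasibleSet K y) :
    (pos w).real Set.univ - (neg w).real Set.univ = (y 0).re := by
  rw [← hw 0 (by simp), fourierCoefficient_eq, integralC_eq_sub w (by fun_prop)]
  simp

lemma re_le_tvNorm {K : ℕ} {y : ℤ → ℂ} {w : RadonMeasure} (hw : w ∈ feasibleSet K y) :
    (y 0).re ≤ tvNorm w := by
  rw [← pos_real_sub_neg_real hw, tvNorm_eq]
  linarith [measureReal_nonneg (μ := neg w) (s := Set.univ)]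

/-- The total mass `ŵ[0] = y 0` never exceeds the norm, so attaining it proves optimality without a
certificate. -/
lemma mem_solutionSet_of_tvNorm_le {K : ℕ} {y : ℤ → ℂ} {w : RadonMeasure}
    (hw : w ∈ feasibleSet K y) (h : tvNorm w ≤ (y 0).re) : w ∈ solutionSet K y :=
  ⟨hw, fun _ hv => h.trans (re_le_tvNorm hv)⟩

lemma tvNorm_of_neg_eq_zero {K : ℕ} {y : ℤ → ℂ} {w : RadonMeasure} (hw : w ∈ feasibleSet K y)
    (h : neg w = 0) : tvNorm w = (y 0).re := by
  rw [← pos_real_sub_neg_real hw, tvNorm_eq, h]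
  simp

lemma apply_nonneg_of_neg_eq_zero {w : RadonMeasure} (h : neg w = 0) (x : Torus) : 0 ≤ w {x} := by
  rw [w.apply_eq_posPart_real_sub_negPart_real (measurableSet_singleton x)]
  change 0 ≤ (pos w).real {x} - (neg w).real {x}
  rw [h]
  simp

lemma IsComposedOf.weight_pos {w : RadonMeasure} (h : neg w = 0) {n : ℕ} {a : Fin n → ℝ}
    {x : Fin n → Torus} (hc : IsComposedOf w a x) (i : Fin n) : 0 < a i :=
  lt_of_le_of_ne (hc.apply_singleton i ▸ apply_nonneg_of_neg_eq_zero h (x i)) (hc.ne_zero i).symm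

/-- If the Toeplitz matrix is positive semidefinite and singular, there is a unique solution, a
positive measure concentrated on at most `K` points. -/
theorem exists_solution_of_posSemidef_of_singular {K : ℕ} {y : ℤ → ℂ}
    (hy : ∀ k : ℤ, |k| ≤ (K : ℤ) → y (-k) = conj (y k)) (hT : (toeplitz K y).PosSemidef)
    {u : Fin (K + 1) → ℂ} (hu : u ≠ 0) (hTu : (toeplitz K y).mulVec u = 0) :
    ∃ w : RadonMeasure, solutionSet K y = {w} ∧ neg w = 0 ∧
      ∃ S : Finset Torus, S.card ≤ K ∧ ∀ᵐ x ∂w.totalVariation, x ∈ S := by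
  obtain ⟨S, hS, hSu⟩ := exists_finset_eval_phase_eq_zero (coeffPoly_ne_zero hu)
  have hSK := hS.trans (natDegree_coeffPoly_le u)
  obtain ⟨-, -, -, -, ⟨w, hw⟩, -⟩ := exists_certificate hy
  have hconc : ∀ v ∈ solutionSet K y, ∀ᵐ x ∂v.totalVariation, x ∈ S := by
    intro v hv
    have hneg := neg_eq_zero_of_posSemidef hy hT hv
    rw [ae_totalVariation_iff, hneg]
    refine ⟨?_, by simp⟩
    -- For a positive solution, `0 = u* T u = ∫ |p_u|² dv` confines `v` to the zeros of `p_u`.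
    have h := star_dotProduct_toeplitz hv.1 u
    rw [hTu, dotProduct_zero, hneg, integral_zero_measure, sub_zero, eq_comm,
      Complex.ofReal_eq_zero, integral_norm_sq_eq_zero_iff] at h
    filter_upwards [h] with x hx using (hSu x).2 hx
  refine ⟨w, Set.eq_singleton_iff_unique_mem.2 ⟨hw, fun v hv => ?_⟩,
    neg_eq_zero_of_posSemidef hy hT hw, S, hSK, hconc w hw⟩
  exact eq_of_mem_feasibleSet hv.1 hw.1 (by omega) (hconc v hv) (hconc w hw)

/-- The rank of the Toeplitz matrix of a positive discrete measure is its number of atoms. -/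
theorem rank_toeplitz_of_isComposedOf {K : ℕ} {y : ℤ → ℂ} {w : RadonMeasure}
    (hw : w ∈ feasibleSet K y) {n : ℕ} (hn : n ≤ K + 1) {a : Fin n → ℝ} {x : Fin n → Torus}
    (hc : IsComposedOf w a x) (ha : ∀ i, 0 < a i) : (toeplitz K y).rank = n := by
  -- A Vandermonde matrix weighted by square roots: `T = B* B`, and the rows of `B` are independent
  -- because `n ≤ K + 1`.
  let B : Matrix (Fin n) (Fin (K + 1)) ℂ :=
    Matrix.of fun l j => (Real.sqrt (a l) : ℂ) * phase (x l) ^ (j : ℕ)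
  have hB : toeplitz K y = B.conjTranspose * B := by
    ext i j
    have hij : |(j : ℤ) - (i : ℤ)| ≤ K := by rw [abs_le]; omega
    rw [toeplitz, Matrix.of_apply, ← hw _ hij, fourierCoefficient_eq, hc.eq_diracSum, diracSum,
      integralC_sum_dirac _ _ _ (by fun_prop), Matrix.mul_apply]
    refine Finset.sum_congr rfl fun l _ => ?_
    have h := fourier_neg_sub_natCast i j (x l)
    have hs : (a l : ℂ) = (Real.sqrt (a l) : ℂ) * (Real.sqrt (a l) : ℂ) := by
      rw [← Complex.ofReal_mul, Real.mul_self_sqrt (ha l).le]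
    rw [h, Matrix.conjTranspose_apply, hs]
    simp only [B, Matrix.of_apply, RCLike.star_def, map_mul, Complex.conj_ofReal]
    ring
  rw [hB, Matrix.rank_conjTranspose_mul_self, LinearIndependent.rank_matrix, Fintype.card_fin]
  rw [Fintype.linearIndependent_iff]
  intro g hg i
  have h0 := eq_zero_of_sum_mul_phase_pow hn hc.injective
    (u := fun l => g l * (Real.sqrt (a l) : ℂ)) fun j hj => by
      have := congrFun hg ⟨j, hj⟩
      simpa [B, Matrix.row, Finset.sum_apply, mul_assoc] using this
  have h1 := (mul_eq_zero.1 (congrFun h0 i)).resolve_right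
    (by exact_mod_cast (Real.sqrt_pos.2 (ha i)).ne')
  exact h1

lemma exists_mulVec_eq_zero_of_rank_lt {n : ℕ} {T : Matrix (Fin n) (Fin n) ℂ} (h : T.rank < n) :
    ∃ u ≠ 0, T.mulVec u = 0 := by
  rw [Matrix.exists_mulVec_eq_zero_iff]
  by_contra hdet
  have := Matrix.rank_of_isUnit T ((Matrix.isUnit_iff_isUnit_det T).2 (isUnit_iff_ne_zero.2 hdet))
  rw [Fintype.card_fin] at this
  omega

/-- The positive semidefinite rank-deficient case. -/
theorem exists_unique_solution_of_posSemidef {K : ℕ} {y : ℤ → ℂ}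
    (hy : ∀ k : ℤ, |k| ≤ (K : ℤ) → y (-k) = conj (y k)) (hT : (toeplitz K y).PosSemidef)
    (hr : (toeplitz K y).rank < K + 1) :
    ∃ w : RadonMeasure, solutionSet K y = {w} ∧
      ∃ (a : Fin (toeplitz K y).rank → ℝ) (x : Fin (toeplitz K y).rank → Torus),
        IsComposedOf w a x ∧ ∀ i, 0 < a i := by
  obtain ⟨u, hu, hTu⟩ := exists_mulVec_eq_zero_of_rank_lt hr
  obtain ⟨w, hw, hneg, S, hS, hwS⟩ := exists_solution_of_posSemidef_of_singular hy hT hu hTu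
  obtain ⟨n, hn, a, x, hc⟩ := exists_isComposedOf hwS
  have hwf : w ∈ feasibleSet K y := (show w ∈ solutionSet K y by rw [hw]; rfl).1
  have ha := hc.weight_pos hneg
  rw [rank_toeplitz_of_isComposedOf hwf (by omega) hc ha]
  exact ⟨w, hw, a, x, hc, ha⟩

lemma exists_ofReal_eq_of_pos {z : ℂ} (h : 0 < z) : ∃ r : ℝ, 0 < r ∧ (r : ℂ) = z :=
  ⟨z.re, (Complex.pos_iff.1 h).1, Complex.ext rfl (Complex.pos_iff.1 h).2⟩

/-- Here `r` is the squared norm of an eigenvector; what matters later is the sign of the form. -/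
lemma exists_star_dotProduct_eq_of_hasEigenvalue {n : ℕ} {T : Matrix (Fin n) (Fin n) ℂ} {l : ℝ}
    (h : Module.End.HasEigenvalue (Matrix.toLin' T) (l : ℂ)) :
    ∃ (u : Fin n → ℂ) (r : ℝ), 0 < r ∧ star u ⬝ᵥ (T.mulVec u) = ((l * r : ℝ) : ℂ) := by
  obtain ⟨u, hu⟩ := h.exists_hasEigenvector
  have h1 : T.mulVec u = (l : ℂ) • u := by simpa using hu.apply_eq_smul
  have h2 : 0 < star u ⬝ᵥ u := Matrix.dotProduct_star_self_pos_iff.2 hu.2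
  obtain ⟨r, hr, hr'⟩ := exists_ofReal_eq_of_pos h2
  exact ⟨u, r, hr, by rw [h1, dotProduct_smul, ← hr', smul_eq_mul, Complex.ofReal_mul]⟩

/-! ### The indefinite case. -/

/-- The indefinite case. -/
theorem exists_unique_solution_of_indefinite {K : ℕ} {y : ℤ → ℂ}
    (hy : ∀ k : ℤ, |k| ≤ (K : ℤ) → y (-k) = conj (y k))
    (hneg : ∃ l : ℝ, l < 0 ∧ Module.End.HasEigenvalue (Matrix.toLin' (toeplitz K y)) (l : ℂ))
    (hpos : ∃ l : ℝ, 0 < l ∧ Module.End.HasEigenvalue (Matrix.toLin' (toeplitz K y)) (l : ℂ)) :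
    ∃ w : RadonMeasure, solutionSet K y = {w} ∧
      ∃ n : ℕ, n ≤ 2 * K ∧ ∃ (a : Fin n → ℝ) (x : Fin n → Torus),
        IsComposedOf w a x ∧ (∃ i, 0 < a i) ∧ ∃ i, a i < 0 := by
  obtain ⟨l₁, hl₁, he₁⟩ := hneg
  obtain ⟨l₂, hl₂, he₂⟩ := hpos
  obtain ⟨u₁, r₁, hr₁, hu₁⟩ := exists_star_dotProduct_eq_of_hasEigenvalue he₁
  obtain ⟨u₂, r₂, hr₂, hu₂⟩ := exists_star_dotProduct_eq_of_hasEigenvalue he₂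
  have hlr₁ := mul_neg_of_neg_of_pos hl₁ hr₁
  have hlr₂ := mul_pos hl₂ hr₂
  obtain ⟨d, η, hη, hη1, ⟨w, hw⟩, hsol⟩ := exists_certificate hy
  -- If `η` were constantly `1`, the solution would be a positive measure and the form could not be
  -- negative at `u₁`.
  have hne1 : ∃ x, η x ≠ 1 := by
    by_contra h
    push Not at h
    have h0 : neg w = 0 := eq_zero_of_ae_false <| by
      filter_upwards [(hsol w hw).2] with x hx
      rw [h] at hx
      norm_num at hx
    rw [star_dotProduct_toeplitz hw.1, h0, integral_zero_measure, sub_zero,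
      Complex.ofReal_inj] at hu₁
    have := integral_nonneg (μ := pos w) (f := fun x => ‖(coeffPoly u₁).eval (phase x)‖ ^ 2)
      fun x => by positivity
    linarith
  have hne2 : ∃ x, η x ≠ -1 := by
    by_contra h
    push Not at h
    have h0 : pos w = 0 := eq_zero_of_ae_false <| by
      filter_upwards [(hsol w hw).1] with x hx
      rw [h] at hx
      norm_num at hx
    rw [star_dotProduct_toeplitz hw.1, h0, integral_zero_measure, zero_sub,
      Complex.ofReal_inj] at hu₂
    have := integral_nonneg (μ := neg w) (f := fun x => ‖(coeffPoly u₂).eval (phase x)‖ ^ 2)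
      fun x => by positivity
    linarith
  obtain ⟨S₁, hS₁, hm₁⟩ := exists_finset_eq_max hη (fun x => (abs_le.1 (hη1 x)).2) hne1
  obtain ⟨S₂, hS₂, hm₂⟩ := exists_finset_eq_min hη (fun x => (abs_le.1 (hη1 x)).1) hne2
  classical
  have hcard : (S₁ ∪ S₂).card ≤ 2 * K := (Finset.card_union_le _ _).trans (by omega)
  have hconc : ∀ v ∈ solutionSet K y, ∀ᵐ x ∂v.totalVariation, x ∈ S₁ ∪ S₂ := by
    intro v hv
    rw [ae_totalVariation_iff]
    constructor
    · filter_upwards [(hsol v hv).1] with x hx using Finset.mem_union_left _ ((hm₁ x).2 hx)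
    · filter_upwards [(hsol v hv).2] with x hx using Finset.mem_union_right _ ((hm₂ x).2 hx)
  obtain ⟨n, hn, a, x, hc⟩ := exists_isComposedOf (hconc w hw)
  have hfeas : diracSum a x ∈ feasibleSet K y := hc.eq_diracSum ▸ hw.1
  refine ⟨w, Set.eq_singleton_iff_unique_mem.2 ⟨hw, fun v hv => ?_⟩, n, hn.trans hcard, a, x, hc,
    ?_, ?_⟩
  · exact eq_of_mem_feasibleSet hv.1 hw.1 (by omega) (hconc v hv) (hconc w hw)
  · by_contra! h
    rw [star_dotProduct_toeplitz_of_diracSum hfeas, Complex.ofReal_inj] at hu₂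
    have : ∑ i, a i * ‖(coeffPoly u₂).eval (phase (x i))‖ ^ 2 ≤ 0 :=
      Finset.sum_nonpos fun i _ => mul_nonpos_of_nonpos_of_nonneg (h i) (by positivity)
    linarith
  · by_contra! h
    rw [star_dotProduct_toeplitz_of_diracSum hfeas, Complex.ofReal_inj] at hu₁
    have : 0 ≤ ∑ i, a i * ‖(coeffPoly u₁).eval (phase (x i))‖ ^ 2 :=
      Finset.sum_nonneg fun i _ => mul_nonneg (h i) (by positivity)
    linarith

/-! ### Change of sign and the negative semidefinite case. -/

lemma fourierCoefficient_neg (w : RadonMeasure) (k : ℤ) :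
    fourierCoefficient (-w) k = -fourierCoefficient w k := integralC_neg w _

lemma toeplitz_neg (K : ℕ) (y : ℤ → ℂ) : toeplitz K (fun k => -y k) = -toeplitz K y := rfl

lemma neg_mem_feasibleSet_iff {K : ℕ} {y : ℤ → ℂ} {w : RadonMeasure} :
    -w ∈ feasibleSet K y ↔ w ∈ feasibleSet K fun k => -y k := by
  simp only [feasibleSet, Set.mem_ofPred_eq, fourierCoefficient_neg, neg_eq_iff_eq_neg]

lemma neg_mem_solutionSet_iff {K : ℕ} {y : ℤ → ℂ} {w : RadonMeasure} :
    -w ∈ solutionSet K y ↔ w ∈ solutionSet K fun k => -y k := by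
  constructor
  · rintro ⟨h1, h2⟩
    refine ⟨neg_mem_feasibleSet_iff.1 h1, fun v hv => ?_⟩
    simpa only [tvNorm_neg] using h2 (-v) (neg_mem_feasibleSet_iff.2 hv)
  · rintro ⟨h1, h2⟩
    refine ⟨neg_mem_feasibleSet_iff.2 h1, fun v hv => ?_⟩
    rw [tvNorm_neg, ← tvNorm_neg v]
    exact h2 (-v) (neg_mem_feasibleSet_iff.1 (by rwa [neg_neg]))

lemma neg_diracSum {n : ℕ} (a : Fin n → ℝ) (x : Fin n → Torus) :
    -diracSum a x = diracSum (-a) x := by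
  rw [diracSum, diracSum, ← Finset.sum_neg_distrib]
  refine Finset.sum_congr rfl fun i _ => ?_
  ext E hE
  by_cases h : x i ∈ E
  · simp [h, hE]
  · simp [h]

lemma IsComposedOf.neg {w : RadonMeasure} {n : ℕ} {a : Fin n → ℝ} {x : Fin n → Torus}
    (h : IsComposedOf w a x) : IsComposedOf (-w) (-a) x :=
  ⟨h.injective, fun i => neg_ne_zero.2 (h.ne_zero i), by rw [h.eq_diracSum, neg_diracSum]⟩

lemma rank_neg_eq {m n : ℕ} (T : Matrix (Fin m) (Fin n) ℂ) : (-T).rank = T.rank := by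
  have h : ∀ T : Matrix (Fin m) (Fin n) ℂ, (-T).rank ≤ T.rank := fun T => by
    have := Matrix.rank_mul_le_left T (-1 : Matrix (Fin n) (Fin n) ℂ)
    simpa using this
  exact (h T).antisymm (by simpa using h (-T))

/-- The negative semidefinite rank-deficient case. -/
theorem exists_unique_solution_of_neg_posSemidef {K : ℕ} {y : ℤ → ℂ}
    (hy : ∀ k : ℤ, |k| ≤ (K : ℤ) → y (-k) = conj (y k)) (hT : (-toeplitz K y).PosSemidef)
    (hr : (toeplitz K y).rank < K + 1) :
    ∃ w : RadonMeasure, solutionSet K y = {w} ∧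
      ∃ (a : Fin (toeplitz K y).rank → ℝ) (x : Fin (toeplitz K y).rank → Torus),
        IsComposedOf w a x ∧ ∀ i, a i < 0 := by
  have h := exists_unique_solution_of_posSemidef (K := K) (y := fun k => -y k)
    (fun k hk => by rw [hy k hk, map_neg]) (by rwa [toeplitz_neg])
    (by rwa [toeplitz_neg, rank_neg_eq])
  rw [toeplitz_neg, rank_neg_eq] at h
  obtain ⟨w, hw, a, x, hc, ha⟩ := h
  refine ⟨-w, ?_, -a, x, hc.neg, fun i => neg_neg_of_pos (ha i)⟩
  ext v
  rw [← neg_neg v, neg_mem_solutionSet_iff, hw, neg_neg]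
  simp [neg_eq_iff_eq_neg]

/-! ### The definite case. -/

/-- Subtracting the right multiple of a rank-one matrix from a positive definite matrix gives a
singular positive semidefinite matrix. -/
theorem exists_sub_vecMulVec_posSemidef {ι : Type*} [Fintype ι] [DecidableEq ι]
    {T : Matrix ι ι ℂ} (hT : T.PosDef) {φ : ι → ℂ} (hφ : φ ≠ 0) :
    ∃ c : ℝ, 0 < c ∧ (T - (c : ℂ) • Matrix.vecMulVec φ (star φ)).PosSemidef ∧
      ∃ v : ι → ℂ, v ≠ 0 ∧ (T - (c : ℂ) • Matrix.vecMulVec φ (star φ)).mulVec v = 0 := by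
  -- With `v = T⁻¹ φ`, the critical constant is `c = 1 / (φ* T⁻¹ φ)`, and `v` spans the new kernel
  -- direction.
  obtain ⟨v, hTv⟩ : ∃ v, T.mulVec v = φ := by
    refine ⟨T⁻¹.mulVec φ, ?_⟩
    rw [Matrix.mulVec_mulVec, Matrix.mul_nonsing_inv _ ((Matrix.isUnit_iff_isUnit_det T).1 hT.isUnit),
      Matrix.one_mulVec]
  have hv : v ≠ 0 := by
    intro h
    rw [h, Matrix.mulVec_zero] at hTv
    exact hφ hTv.symm
  obtain ⟨r, hr, hrv⟩ := exists_ofReal_eq_of_pos (hT.dotProduct_mulVec_pos hv)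
  have hstar : ∀ z, star v ⬝ᵥ T.mulVec z = star φ ⬝ᵥ z := by
    intro z
    rw [Matrix.dotProduct_mulVec, ← hTv, Matrix.star_mulVec, hT.isHermitian.eq]
  have hφv : star φ ⬝ᵥ v = r := by rw [← hstar, hrv]
  have hrc : (r : ℂ) ≠ 0 := by exact_mod_cast hr.ne'
  have happ : ∀ z, (T - ((r⁻¹ : ℝ) : ℂ) • Matrix.vecMulVec φ (star φ)).mulVec z =
      T.mulVec z - ((r : ℂ)⁻¹ * (star φ ⬝ᵥ z)) • φ := by
    intro z
    rw [Matrix.sub_mulVec, Matrix.smul_mulVec, Matrix.vecMulVec_mulVec]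
    ext i
    simp
    ring
  refine ⟨r⁻¹, inv_pos.2 hr, Matrix.PosSemidef.of_dotProduct_mulVec_nonneg ?_ fun u => ?_,
    v, hv, ?_⟩
  · refine hT.isHermitian.sub ?_
    rw [Matrix.IsHermitian, Matrix.conjTranspose_smul,
      (Matrix.posSemidef_vecMulVec_self_star φ).isHermitian.eq]
    simp
  -- The `T`-orthogonal splitting `u = z + β v` makes `z` orthogonal to `φ` and reduces the form at
  -- `u` to `z* T z`.
  · set β := (r : ℂ)⁻¹ * (star φ ⬝ᵥ u) with hβ
    set z := u - β • v with hz
    have hφz : star φ ⬝ᵥ z = 0 := by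
      rw [hz, dotProduct_sub, dotProduct_smul, hφv, hβ, smul_eq_mul]
      field_simp
      ring
    have hu : T.mulVec u - β • φ = T.mulVec z := by
      rw [hz, Matrix.mulVec_sub, Matrix.mulVec_smul, hTv]
    rw [happ, ← hβ, hu]
    have hu' : star u = star z + star β • star v := by
      rw [hz, star_sub, star_smul, sub_add_cancel]
    rw [hu', add_dotProduct, smul_dotProduct, hstar, hφz, smul_zero, add_zero]
    exact hT.posSemidef.dotProduct_mulVec_nonneg z
  · rw [happ, hTv, hφv, inv_mul_cancel₀ hrc, one_smul, sub_self]

/-- A measure whose Toeplitz matrix is positive definite has at least `K + 1` atoms. -/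
theorem le_of_diracSum_mem_feasibleSet {K : ℕ} {y : ℤ → ℂ} (hT : (toeplitz K y).PosDef) {n : ℕ}
    {a : Fin n → ℝ} {x : Fin n → Torus} (hw : diracSum a x ∈ feasibleSet K y) : K + 1 ≤ n := by
  classical
  by_contra! hn
  -- With at most `K` atoms, some nonzero `p_u` vanishes at all of them, making the form zero at `u
  -- ≠ 0`.
  obtain ⟨u, hu, hux⟩ := exists_coeff_vanishing (K := K) (S := Finset.univ.image x)
    (Finset.card_image_le.trans (by simpa using Nat.lt_succ_iff.1 hn))
  have h := hT.dotProduct_mulVec_pos hu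
  rw [star_dotProduct_toeplitz_of_diracSum hw, Finset.sum_eq_zero fun i _ => by
    rw [(hux (x i)).2 (Finset.mem_image_of_mem x (Finset.mem_univ i))]; simp] at h
  simp at h

lemma tvNorm_add_le (w v : RadonMeasure) : tvNorm (w + v) ≤ tvNorm w + tvNorm v := by
  simp only [tvNorm, SignedMeasure.totalVariation_eq_variation]
  rw [← measureReal_add_apply]
  exact ENNReal.toReal_mono (measure_ne_top _ _) (VectorMeasure.variation_add_le _)

lemma tvNorm_dirac (s : Torus) (c : ℝ) : tvNorm (VectorMeasure.dirac s c) = |c| := by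
  rw [tvNorm, SignedMeasure.totalVariation_eq_variation, VectorMeasure.variation_dirac]
  simp [Measure.real]

lemma ae_mem_insert_add_dirac {w : RadonMeasure} {S : Finset Torus} [DecidableEq Torus]
    (h : ∀ᵐ x ∂w.totalVariation, x ∈ S) (s : Torus) (c : ℝ) :
    ∀ᵐ x ∂(w + VectorMeasure.dirac s c).totalVariation, x ∈ insert s S := by
  rw [SignedMeasure.totalVariation_eq_variation] at h ⊢
  refine Filter.Eventually.filter_mono (ae_mono VectorMeasure.variation_add_le) ?_
  rw [VectorMeasure.variation_dirac]
  refine ae_add_measure_iff.2 ⟨?_, Measure.ae_smul_measure ?_ _⟩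
  · filter_upwards [h] with x hx using Finset.mem_insert_of_mem hx
  · rw [ae_dirac_iff (by measurability)]
    exact Finset.mem_insert_self _ _

/-- In the positive definite case, every point is an atom of a solution with `K + 1` atoms. -/
theorem exists_solution_with_atom {K : ℕ} {y : ℤ → ℂ}
    (hy : ∀ k : ℤ, |k| ≤ (K : ℤ) → y (-k) = conj (y k)) (hT : (toeplitz K y).PosDef) (s : Torus) :
    ∃ w ∈ solutionSet K y, ∃ (a : Fin (K + 1) → ℝ) (x : Fin (K + 1) → Torus),
      IsComposedOf w a x ∧ (∀ i, 0 < a i) ∧ s ∈ Set.range x := by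
  classical
  -- Chosen so that `c φ φ*` is the Toeplitz matrix of `c δ_s`.
  let φ : Fin (K + 1) → ℂ := fun i => conj (phase s ^ (i : ℕ))
  have hφ : φ ≠ 0 := fun h => by simpa [φ] using congrFun h 0
  obtain ⟨c, hc, hpsd, v, hv, hTv⟩ := exists_sub_vecMulVec_posSemidef hT hφ
  have htoep : toeplitz K (fun k => y k - c * fourier (-k) s) =
      toeplitz K y - (c : ℂ) • Matrix.vecMulVec φ (star φ) := by
    ext i j
    have h := fourier_neg_sub_natCast i j s
    simp only [toeplitz, Matrix.of_apply, Matrix.sub_apply, Matrix.smul_apply,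
      Matrix.vecMulVec_apply, Pi.star_apply, h, φ, smul_eq_mul, RCLike.star_def, Complex.conj_conj]
  rw [← htoep] at hpsd hTv
  obtain ⟨w', hw', hneg, S, hS, hwS⟩ := exists_solution_of_posSemidef_of_singular
    (fun k hk => by rw [hy k hk, fourier_conj_symm, map_sub, map_mul, Complex.conj_ofReal])
    hpsd hv hTv
  have hwf' : w' ∈ feasibleSet K fun k => y k - c * fourier (-k) s :=
    (show w' ∈ solutionSet K _ by rw [hw']; rfl).1
  obtain ⟨w, hw⟩ : ∃ w, w = w' + VectorMeasure.dirac s c := ⟨_, rfl⟩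
  have hwf : w ∈ feasibleSet K y := by
    intro k hk
    rw [fourierCoefficient_eq, hw, integralC_add _ _ (by fun_prop), integralC_dirac,
      ← fourierCoefficient_eq, hwf' k hk, sub_add_cancel]
  have hsol : w ∈ solutionSet K y := by
    -- The norm is at most `(y 0 - c) + c`, the total mass.
    apply mem_solutionSet_of_tvNorm_le hwf
    rw [hw]
    refine (tvNorm_add_le _ _).trans_eq ?_
    rw [tvNorm_of_neg_eq_zero hwf' hneg, tvNorm_dirac, abs_of_pos hc]
    simp
  have hnegw := neg_eq_zero_of_posSemidef hy hT.posSemidef hsol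
  obtain ⟨n, hn, a, x, hcomp⟩ := exists_isComposedOf (hw ▸ ae_mem_insert_add_dirac hwS s c)
  have hn1 := le_of_diracSum_mem_feasibleSet hT (hcomp.eq_diracSum ▸ hwf)
  -- At most `K` points from `S` together with `s`, and at least `K + 1` by definiteness.
  obtain rfl : n = K + 1 :=
    le_antisymm (hn.trans ((Finset.card_insert_le _ _).trans (Nat.succ_le_succ hS))) hn1
  refine ⟨w, hsol, a, x, hcomp, hcomp.weight_pos hnegw, ?_⟩
  -- The mass at `s` is `w' {s} + c`, positive because `w'` is a positive measure.
  by_contra hs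
  have h0 := diracSum_apply_singleton_of_notMem a hs
  rw [← hcomp.eq_diracSum, hw, add_apply,
    VectorMeasure.dirac_apply_of_mem (measurableSet_singleton s) rfl] at h0
  linarith [apply_nonneg_of_neg_eq_zero hneg s]

lemma not_countable_univ_torus : ¬ (Set.univ : Set Torus).Countable := by
  intro h
  have h1 : (Set.Ico (0 : ℝ) (0 + 2 * Real.pi)).Countable := by
    have : Countable Torus := Set.countable_univ_iff.1 h
    exact Set.countable_coe_iff.1
      (AddCircle.equivIco (2 * Real.pi) 0).symm.injective.countable
  rw [← Cardinal.le_aleph0_iff_set_countable, Cardinal.mk_Ico_real (by simpa using Real.pi_pos)] at h1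
  exact h1.not_gt Cardinal.aleph0_lt_continuum

/-- In the positive definite case, there are uncountably many solutions with `K + 1` atoms. -/
theorem not_countable_solutions {K : ℕ} {y : ℤ → ℂ}
    (hy : ∀ k : ℤ, |k| ≤ (K : ℤ) → y (-k) = conj (y k)) (hT : (toeplitz K y).PosDef) :
    ¬ {w ∈ solutionSet K y | ∃ (a : Fin (K + 1) → ℝ) (x : Fin (K + 1) → Torus),
      IsComposedOf w a x ∧ ∀ i, 0 < a i}.Countable := by
  intro hcount
  apply not_countable_univ_torus
  -- The atoms of these solutions cover the torus and each solution has finitely many, so countably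
  -- many solutions could not suffice.
  refine (hcount.biUnion (t := fun w _ => {s : Torus | w {s} ≠ 0}) ?_).mono ?_
  · rintro w ⟨-, a, x, hc, -⟩
    refine (Set.finite_range x).countable.mono fun s hs => ?_
    by_contra h
    exact hs (hc.eq_diracSum ▸ diracSum_apply_singleton_of_notMem a h)
  · intro s _
    obtain ⟨w, hw, a, x, hc, ha, i, rfl⟩ := exists_solution_with_atom hy hT s
    exact Set.mem_biUnion (x := w) ⟨hw, a, x, hc, ha⟩
      (by simpa [hc.apply_singleton i] using (ha i).ne')

/-- The positive definite case. -/
theorem solutionSet_of_posDef {K : ℕ} {y : ℤ → ℂ}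
    (hy : ∀ k : ℤ, |k| ≤ (K : ℤ) → y (-k) = conj (y k)) (hT : (toeplitz K y).PosDef) :
    (toeplitz K y).rank = K + 1 ∧ (solutionSet K y).Infinite ∧
      (∀ w ∈ solutionSet K y, ∀ n : ℕ, n < K + 1 →
        ∀ (a : Fin n → ℝ) (x : Fin n → Torus), w ≠ diracSum a x) ∧
      ¬ {w ∈ solutionSet K y | ∃ (a : Fin (K + 1) → ℝ) (x : Fin (K + 1) → Torus),
          IsComposedOf w a x ∧ ∀ i, 0 < a i}.Countable := by
  refine ⟨?_, fun hfin => ?_, ?_, not_countable_solutions hy hT⟩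
  · rw [Matrix.rank_of_isUnit _ hT.isUnit, Fintype.card_fin]
  · exact not_countable_solutions hy hT (hfin.countable.mono fun w hw => hw.1)
  · rintro _ hw n hn a x rfl
    exact hn.not_ge (le_of_diracSum_mem_feasibleSet hT hw.1)

/-- The negative definite case. -/
theorem solutionSet_of_neg_posDef {K : ℕ} {y : ℤ → ℂ}
    (hy : ∀ k : ℤ, |k| ≤ (K : ℤ) → y (-k) = conj (y k)) (hT : (-toeplitz K y).PosDef) :
    (toeplitz K y).rank = K + 1 ∧ (solutionSet K y).Infinite ∧
      (∀ w ∈ solutionSet K y, ∀ n : ℕ, n < K + 1 →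
        ∀ (a : Fin n → ℝ) (x : Fin n → Torus), w ≠ diracSum a x) ∧
      ¬ {w ∈ solutionSet K y | ∃ (a : Fin (K + 1) → ℝ) (x : Fin (K + 1) → Torus),
          IsComposedOf w a x ∧ ∀ i, a i < 0}.Countable := by
  obtain ⟨h1, h2, h3, h4⟩ := solutionSet_of_posDef (K := K) (y := fun k => -y k)
    (fun k hk => by rw [hy k hk, map_neg]) (by rwa [toeplitz_neg])
  have hsol : ∀ w, w ∈ solutionSet K y → -w ∈ solutionSet K fun k => -y k := fun w hw =>
    neg_mem_solutionSet_iff.1 (by rwa [neg_neg])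
  refine ⟨by rwa [toeplitz_neg, rank_neg_eq] at h1, fun hfin => h2 ?_, fun w hw n hn a x hwa => ?_,
    fun hcount => h4 ?_⟩
  · refine (hfin.image Neg.neg).subset fun w hw => ?_
    exact ⟨-w, neg_mem_solutionSet_iff.2 hw, neg_neg w⟩
  · exact h3 (-w) (hsol w hw) n hn (-a) x (by rw [hwa, neg_diracSum])
  · refine (hcount.image Neg.neg).mono ?_
    rintro w ⟨hw, a, x, hc, ha⟩
    exact ⟨-w, ⟨neg_mem_solutionSet_iff.2 hw, -a, x, hc.neg, fun i => neg_neg_of_pos (ha i)⟩,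
      neg_neg w⟩

end BPC

theorem mainTheorem1 (K : ℕ) (y : ℤ → ℂ)
    (hy : ∀ k : ℤ, |k| ≤ (K : ℤ) → y (-k) = conj (y k)) :
    -- one negative and one positive eigenvalue
    ((∃ l : ℝ, l < 0 ∧
        Module.End.HasEigenvalue (Matrix.toLin' (BPC.toeplitz K y)) (l : ℂ)) →
      (∃ l : ℝ, 0 < l ∧
        Module.End.HasEigenvalue (Matrix.toLin' (BPC.toeplitz K y)) (l : ℂ)) →
      ∃ w : BPC.RadonMeasure, BPC.solutionSet K y = {w} ∧
        ∃ n : ℕ, n ≤ 2 * K ∧ ∃ (a : Fin n → ℝ) (x : Fin n → BPC.Torus),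
          BPC.IsComposedOf w a x ∧ (∃ i, 0 < a i) ∧ (∃ i, a i < 0)) ∧
    -- positive semi-definite and rank deficient
    ((BPC.toeplitz K y).PosSemidef → (BPC.toeplitz K y).rank < K + 1 →
      ∃ w : BPC.RadonMeasure, BPC.solutionSet K y = {w} ∧
        ∃ (a : Fin (BPC.toeplitz K y).rank → ℝ) (x : Fin (BPC.toeplitz K y).rank → BPC.Torus),
          BPC.IsComposedOf w a x ∧ ∀ i, 0 < a i) ∧
    -- negative semi-definite and rank deficient
    ((-BPC.toeplitz K y).PosSemidef → (BPC.toeplitz K y).rank < K + 1 →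
      ∃ w : BPC.RadonMeasure, BPC.solutionSet K y = {w} ∧
        ∃ (a : Fin (BPC.toeplitz K y).rank → ℝ) (x : Fin (BPC.toeplitz K y).rank → BPC.Torus),
          BPC.IsComposedOf w a x ∧ ∀ i, a i < 0) ∧
    -- positive definite
    ((BPC.toeplitz K y).PosDef →
      (BPC.toeplitz K y).rank = K + 1 ∧
      (BPC.solutionSet K y).Infinite ∧
      (∀ w ∈ BPC.solutionSet K y, ∀ n : ℕ, n < K + 1 →
        ∀ (a : Fin n → ℝ) (x : Fin n → BPC.Torus), w ≠ BPC.diracSum a x) ∧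
      ¬ {w ∈ BPC.solutionSet K y | ∃ (a : Fin (K + 1) → ℝ) (x : Fin (K + 1) → BPC.Torus),
          BPC.IsComposedOf w a x ∧ ∀ i, 0 < a i}.Countable) ∧
    -- negative definite
    ((-BPC.toeplitz K y).PosDef →
      (BPC.toeplitz K y).rank = K + 1 ∧
      (BPC.solutionSet K y).Infinite ∧
      (∀ w ∈ BPC.solutionSet K y, ∀ n : ℕ, n < K + 1 →
        ∀ (a : Fin n → ℝ) (x : Fin n → BPC.Torus), w ≠ BPC.diracSum a x) ∧
      ¬ {w ∈ BPC.solutionSet K y | ∃ (a : Fin (K + 1) → ℝ) (x : Fin (K + 1) → BPC.Torus),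
          BPC.IsComposedOf w a x ∧ ∀ i, a i < 0}.Countable) :=
  ⟨BPC.exists_unique_solution_of_indefinite hy, BPC.exists_unique_solution_of_posSemidef hy,
    BPC.exists_unique_solution_of_neg_posSemidef hy, BPC.solutionSet_of_posDef hy,
    BPC.solutionSet_of_neg_posDef hy⟩
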